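/- Let $\Omega=[0,1]^3$ and let $f:\Omega\to\mathbb R$ be continuous with $\Delta_x\Delta_y f\ge 0$, $\Delta_x\Delta_z f\ge 0$, $\Delta_y\Delta_z f\ge 0$ on $\Omega$ for all nonnegative increments that stay in $\Omega$; here e.g. $\Delta_x\Delta_y f(u,v,w)=f(u+x,v+y,w)-f(u+x,v,w)-f(u,v+y,w)+f(u,v,w)$. Let $$E(f,\Omega)=\inf_{\varphi,\psi,\omega\in C[0,1]}\ \sup_{(x,y,z)\in\Omega}|f(x,y,z)-\varphi(x)-\psi(y)-\omega(z)|.$$ A projection cycle-vector $(p,\lambda)$ consists of a nonempty finite set $p=\{x_1,\dots,x_m\}\subset\Omega$ and nonzero reals $\lambda_1,\dots,\lambda_m$ such that, for every plane parallel to a coordinate plane, the $\lambda_i$ with $x_i$ on that plane sum to $0$. Then $p$ is called a projection cycle; $p$, and with it $(p,\lambda)$, is called minimal if no proper subset of $p$ is a projection cycle. Define on $\Omega$ $$\begin{aligned} g_1&=f(x,y,z)-f(x,0,1)-f(1,y,0)-f(0,1,z), & g_2&=f(x,y,z)-f(1,0,z)-f(x,1,0)-f(0,y,1),\\ g_3&=f(x,y,z)-f(x,0,1)-f(1,0,z)-f(1,y,0),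 & g_4&=f(x,y,z)-f(1,0,z)-f(1,y,0)-f(x,1,0),\\ g_5&=f(x,y,z)-f(1,y,0)-f(x,1,0)-f(0,1,z), & g_6&=f(x,y,z)-f(x,1,0)-f(0,1,z)-f(0,y,1),\\ g_7&=f(x,y,z)-f(0,1,z)-f(0,y,1)-f(x,0,1), & g_8&=f(x,y,z)-f(0,y,1)-f(x,0,1)-f(1,0,z), \end{aligned}$$ and, on the faces $z=0$, $z=1$, $y=0$, $y=1$, $x=0$, $x=1$ respectively, $$\begin{aligned} h_1&=f(x,y,0)-f(0,y,1)-f(x,0,1), & h_2&=f(x,y,1)-f(1,y,0)-f(x,1,0),\\ h_3&=f(x,0,z)-f(0,1,z)-f(x,1,0), & h_4&=f(x,1,z)-f(1,0,z)-f(x,0,1),\\ h_5&=f(0,y,z)-f(1,0,z)-f(1,y,0), & h_6&=f(1,y,z)-f(0,1,z)-f(0,y,1). \end{aligned}$$ Then maximum points $M_i\in\Omega$ of $g_i$ ($1\le i\le 8$) and $F_i$ of $h_i$ on its face ($1\le i\le 6$) exist. Moreover, for every choice of such maximum points, let $U$ be the finite set consisting of the eight vertices of $\Omega$ and all the points $M_i$,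 $F_i$, and let $U_x,U_y,U_z$ be its projections to the coordinate axes. Then there are only finitely many minimal projection cycle-vectors with all points in $U_x\times U_y\times U_z$ and $\sum_i|\lambda_i|=1$, and $$E(f,\Omega)=\max_{(p,\lambda)}\ \frac{\sum_i\lambda_i f(x_i)}{\sum_i|\lambda_i|},$$ where the maximum is attained and runs over all minimal projection cycle-vectors $(p,\lambda)$ with all points in $U_x\times U_y\times U_z$. -/

import Mathlib

open scoped unitInterval

noncomputable section

namespace SumApprox

section Cycles

variable {ι : Type*} {X : ι → Type*}

open Classical in
/-- A projection cycle-vector `(p, λ)` on the product `∏ j, X j`: finitely many points `p` (at least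
one) with nonzero real weights `λ` such that for every coordinate `j` and every `ξ`, the weights of
the points of `p` whose `j`-th coordinate is `ξ` sum to zero. It is encoded by the finitely supported
weight function `l`; the set of points is `p = l.support`, where the weights are nonzero. -/
def IsCycleVector (l : (∀ j, X j) →₀ ℝ) : Prop :=
  l ≠ 0 ∧ ∀ (j : ι) (ξ : X j), ∑ x ∈ l.support with x j = ξ, l x = 0

/-- A finite set of points is a projection cycle if it carries nonzero weights making it a projection
cycle-vector. -/
def IsCycle (p : Finset (∀ j, X j)) : Prop :=
  ∃ l : (∀ j, X j) →₀ ℝ, IsCycleVector l ∧ l.support = p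

/-- A projection cycle is minimal if no proper subset of it is a projection cycle. -/
def IsMinimalCycle (p : Finset (∀ j, X j)) : Prop :=
  IsCycle p ∧ ∀ q : Finset (∀ j, X j), q ⊂ p → ¬ IsCycle q

/-- The set `X_{S,min}` of minimal projection cycle-vectors with all points in `S`. -/
def minimalCycleVectors (S : Set (∀ j, X j)) : Set ((∀ j, X j) →₀ ℝ) :=
  {l | IsCycleVector l ∧ IsMinimalCycle l.support ∧ (l.support : Set (∀ j, X j)) ⊆ S}

/-- The sum `∑ |λ_i|` of the absolute weights. -/
def totalWeight (l : (∀ j, X j) →₀ ℝ) : ℝ := ∑ x ∈ l.support, |l x|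

/-- The objective `∑ λ_i f(x_i) / ∑ |λ_i|`. -/
def objective (f : (∀ j, X j) → ℝ) (l : (∀ j, X j) →₀ ℝ) : ℝ :=
  (∑ x ∈ l.support, l x * f x) / totalWeight l

/-- The grid `∏ j, U_j`, where `U_j` is the projection of `U` to the `j`-th coordinate. -/
def grid (U : Set (∀ j, X j)) : Set (∀ j, X j) :=
  {x | ∀ j, x j ∈ (fun u : ∀ j, X j => u j) '' U}

end Cycles

/-- The unit cube `[0,1]³`; the coordinates `x, y, z` have the indices `0, 1, 2`. -/
abbrev Cube : Type := Fin 3 → I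

/-- The best uniform approximation error `E(f, Ω)` of `f` by sums `φ(x) + ψ(y) + ω(z)` of continuous
functions of one variable; the norm is the supremum norm on `C(Ω)`. -/
def approxError (f : C(Cube, ℝ)) : ℝ :=
  ⨅ g : C(I, ℝ) × C(I, ℝ) × C(I, ℝ),
    ‖f - (g.1.comp ⟨fun u : Cube => u 0, continuous_apply 0⟩
        + g.2.1.comp ⟨fun u : Cube => u 1, continuous_apply 1⟩
        + g.2.2.comp ⟨fun u : Cube => u 2, continuous_apply 2⟩)‖

/-- The partial difference of `f` at `u` when the `i`-th coordinate moves from `u i` to `a`, that is,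
with increment `a - u i`. -/
def partialDiff (i : Fin 3) (a : I) (f : Cube → ℝ) (u : Cube) : ℝ :=
  f (Function.update u i a) - f u

/-- `Δ_i Δ_j f ≥ 0`: all mixed second differences of `f` in the coordinates `i`, `j`, with
nonnegative increments that stay inside the cube, are nonnegative. -/
def MixedDiffNonneg (i j : Fin 3) (f : Cube → ℝ) : Prop :=
  ∀ (u : Cube) (a b : I), u i ≤ a → u j ≤ b →
    0 ≤ partialDiff i a (partialDiff j b f) u

/-- The vertices `T_1, …, T_8` of the cube. -/
def vertex : Fin 8 → Cube :=
  ![![0, 0, 0], ![0, 0, 1], ![1, 0, 1], ![1, 0, 0],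
    ![1, 1, 0], ![0, 1, 0], ![0, 1, 1], ![1, 1, 1]]

/-- The auxiliary functions `g_1, …, g_8` on the cube. -/
def auxG (f : Cube → ℝ) (i : Fin 8) (u : Cube) : ℝ :=
  let x := u 0
  let y := u 1
  let z := u 2
  match i with
  | 0 => f ![x, y, z] - f ![x, 0, 1] - f ![1, y, 0] - f ![0, 1, z]
  | 1 => f ![x, y, z] - f ![1, 0, z] - f ![x, 1, 0] - f ![0, y, 1]
  | 2 => f ![x, y, z] - f ![x, 0, 1] - f ![1, 0, z] - f ![1, y, 0]
  | 3 => f ![x, y, z] - f ![1, 0, z] - f ![1, y, 0] - f ![x, 1, 0]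
  | 4 => f ![x, y, z] - f ![1, y, 0] - f ![x, 1, 0] - f ![0, 1, z]
  | 5 => f ![x, y, z] - f ![x, 1, 0] - f ![0, 1, z] - f ![0, y, 1]
  | 6 => f ![x, y, z] - f ![0, 1, z] - f ![0, y, 1] - f ![x, 0, 1]
  | 7 => f ![x, y, z] - f ![0, y, 1] - f ![x, 0, 1] - f ![1, 0, z]

/-- The faces `z = 0`, `z = 1`, `y = 0`, `y = 1`, `x = 0`, `x = 1` of the cube. -/
def face : Fin 6 → Set Cube :=
  ![{u | u 2 = 0}, {u | u 2 = 1}, {u | u 1 = 0}, {u | u 1 = 1}, {u | u 0 = 0}, {u | u 0 = 1}]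

/-- The auxiliary functions `h_1, …, h_6`; `h_i` is used only on `face i`. -/
def auxH (f : Cube → ℝ) (i : Fin 6) (u : Cube) : ℝ :=
  let x := u 0
  let y := u 1
  let z := u 2
  match i with
  | 0 => f ![x, y, 0] - f ![0, y, 1] - f ![x, 0, 1]
  | 1 => f ![x, y, 1] - f ![1, y, 0] - f ![x, 1, 0]
  | 2 => f ![x, 0, z] - f ![0, 1, z] - f ![x, 1, 0]
  | 3 => f ![x, 1, z] - f ![1, 0, z] - f ![x, 0, 1]
  | 4 => f ![0, y, z] - f ![1, 0, z] - f ![1, y, 0]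
  | 5 => f ![1, y, z] - f ![0, 1, z] - f ![0, y, 1]

/-- `M_i` is a maximum point of `g_i` on the cube, and `F_i` is a maximum point of `h_i` on the
`i`-th face. -/
def AreMaximizers (f : Cube → ℝ) (M : Fin 8 → Cube) (F : Fin 6 → Cube) : Prop :=
  (∀ i, ∀ u : Cube, auxG f i u ≤ auxG f i (M i)) ∧
    ∀ i, F i ∈ face i ∧ ∀ u ∈ face i, auxH f i u ≤ auxH f i (F i)

/-- The set `U` of all `T_i`, `M_i` and `F_i`. -/
def nodeSet (M : Fin 8 → Cube) (F : Fin 6 → Cube) : Set Cube :=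
  Set.range vertex ∪ Set.range M ∪ Set.range F

end SumApprox

end

/-! Weak duality is immediate: a cycle vector annihilates functions of one coordinate, so its
objective never exceeds the error. On a finite grid, Hahn–Banach gives equality, and halving a cycle
vector along a subordinate one makes the optimal vector minimal (`exists_best_approx_eq_objective`).
The error on the cube is controlled by errors on fine grids, by averaging grid solutions with
partitions of unity (`approxError_le_of_grids`). What remains is that refining the grid of the nodes
never increases the error.

On a refined grid, split a cycle vector into positive and negative parts, two measures `a`, `b` with
equal marginals. Among the pairs of largest value choose one that maximizes the integral of an
auxiliary potential against `a`. Any balanced exchange of support points that loses no value must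
then not raise the potential (`IsOptimalPlan.potential_move_le`), and each localization step
exhibits a forbidden exchange.

The difference conditions make `f` supermodular, so the positive points form a chain. If a positive
and a negative point share an interior coordinate and are comparable in the other two, both can be
pushed to an endpoint; hence they cross. With the chain property, this confines each negative point
with an interior coordinate to the hexagon of six edges avoiding the vertices 000 and 111.
Consequently `f` at a positive point inside the cube or a face, minus `f` at its negative partners,
is a value of some `g_i` or `h_i`, and the points can be moved so that this value becomes the
maximum. Points on edges need a separate exchange argument. So positive points lie on the node grid
(`IsOptimalPlan.left_node`), negative points follow through shared coordinates, and weak duality on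
the node grid bounds the value (`planValue_le_of_nodes`). -/

noncomputable section

namespace SumApprox

/-! ### Duality on finite sets and minimal cycle vectors -/

section Duality

variable {ι : Type*} {X : ι → Type*}

/-- The pairing `∑ λ_i f(x_i)` of a weight vector with a function. -/
def pairing (f : (∀ j, X j) → ℝ) : ((∀ j, X j) →₀ ℝ) →ₗ[ℝ] ℝ := Finsupp.linearCombination ℝ f

lemma pairing_apply (f : (∀ j, X j) → ℝ) (l : (∀ j, X j) →₀ ℝ) :
    pairing f l = ∑ x ∈ l.support, l x * f x := by
  simp [pairing, Finsupp.linearCombination_apply, Finsupp.sum]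

lemma pairing_eq_sum (f : (∀ j, X j) → ℝ) {l : (∀ j, X j) →₀ ℝ} {G : Finset (∀ j, X j)}
    (h : l.support ⊆ G) : pairing f l = ∑ x ∈ G, l x * f x := by
  rw [pairing_apply]
  refine Finset.sum_subset h fun x _ hx => ?_
  simp [Finsupp.notMem_support_iff.1 hx]

lemma totalWeight_eq_sum {l : (∀ j, X j) →₀ ℝ} {G : Finset (∀ j, X j)}
    (h : l.support ⊆ G) : totalWeight l = ∑ x ∈ G, |l x| := by
  refine Finset.sum_subset h fun x _ hx => ?_
  simp [Finsupp.notMem_support_iff.1 hx]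

lemma totalWeight_pos {l : (∀ j, X j) →₀ ℝ} (h : l ≠ 0) : 0 < totalWeight l :=
  Finset.sum_pos (fun _ hx => abs_pos.2 (Finsupp.mem_support_iff.1 hx))
    (Finsupp.support_nonempty_iff.2 h)

lemma totalWeight_smul (t : ℝ) (l : (∀ j, X j) →₀ ℝ) :
    totalWeight (t • l) = |t| * totalWeight l := by
  rw [totalWeight_eq_sum (Finsupp.support_smul (b := t) (g := l)), totalWeight, Finset.mul_sum]
  simp [abs_mul]

lemma objective_eq (f : (∀ j, X j) → ℝ) (l : (∀ j, X j) →₀ ℝ) :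
    objective f l = pairing f l / totalWeight l := by
  rw [objective, pairing_apply]

/-- A nonzero vector is a cycle vector iff it annihilates all functions of one coordinate. -/
lemma isCycleVector_iff {l : (∀ j, X j) →₀ ℝ} :
    IsCycleVector l ↔ l ≠ 0 ∧ ∀ j (φ : X j → ℝ), pairing (fun x => φ (x j)) l = 0 := by
  classical
  refine and_congr_right fun _ => ⟨fun h j φ => ?_, fun h j ξ => ?_⟩
  · rw [pairing_apply, ← Finset.sum_fiberwise_of_maps_to
      (t := l.support.image fun x => x j) (g := fun x => x j)
      (fun x hx => Finset.mem_image_of_mem _ hx)]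
    refine Finset.sum_eq_zero fun ξ _ => ?_
    have h1 := h j ξ
    calc _ = ∑ x ∈ l.support with x j = ξ, l x * φ ξ :=
          Finset.sum_congr rfl fun x hx => by rw [(Finset.mem_filter.1 hx).2]
      _ = (∑ x ∈ l.support with x j = ξ, l x) * φ ξ := by rw [Finset.sum_mul]
      _ = 0 := by
        have : (∑ x ∈ l.support with x j = ξ, l x) = 0 := by convert h1
        rw [this, zero_mul]
  · have h1 := h j (fun η => if η = ξ then 1 else 0)
    rw [pairing_apply] at h1
    simp only [mul_ite, mul_one, mul_zero, ← Finset.sum_filter] at h1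
    convert h1

lemma IsCycleVector.pairing_eq_zero {l : (∀ j, X j) →₀ ℝ} (h : IsCycleVector l) (j : ι)
    (φ : X j → ℝ) : pairing (fun x => φ (x j)) l = 0 :=
  (isCycleVector_iff.1 h).2 j φ

lemma IsCycleVector.smul {l : (∀ j, X j) →₀ ℝ} (h : IsCycleVector l) {t : ℝ} (ht : t ≠ 0) :
    IsCycleVector (t • l) := by
  refine isCycleVector_iff.2 ⟨smul_ne_zero ht h.1, fun j φ => ?_⟩
  rw [map_smul, h.pairing_eq_zero, smul_zero]

lemma IsCycleVector.sub {l l' : (∀ j, X j) →₀ ℝ} (h : IsCycleVector l) (h' : IsCycleVector l')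
    (hne : l ≠ l') : IsCycleVector (l - l') := by
  refine isCycleVector_iff.2 ⟨sub_ne_zero.2 hne, fun j φ => ?_⟩
  rw [map_sub, h.pairing_eq_zero, h'.pairing_eq_zero, sub_zero]

/-- Weak duality. -/
lemma IsCycleVector.pairing_le [Fintype ι] {f : (∀ j, X j) → ℝ} {l : (∀ j, X j) →₀ ℝ}
    (h : IsCycleVector l) {u : ∀ j, X j → ℝ} {c : ℝ}
    (hu : ∀ x ∈ l.support, |f x - ∑ j, u j (x j)| ≤ c) :
    pairing f l ≤ c * totalWeight l := by
  have h1 : pairing f l = ∑ x ∈ l.support, l x * (f x - ∑ j, u j (x j)) := by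
    have : ∑ x ∈ l.support, l x * ∑ j, u j (x j) = 0 := by
      simp_rw [Finset.mul_sum]
      rw [Finset.sum_comm]
      refine Finset.sum_eq_zero fun j _ => ?_
      rw [← pairing_apply (fun x => u j (x j)), h.pairing_eq_zero]
    simp only [mul_sub, Finset.sum_sub_distrib, this, sub_zero, pairing_apply]
  rw [h1, totalWeight, Finset.mul_sum]
  refine Finset.sum_le_sum fun x hx => ?_
  calc _ ≤ |l x * (f x - ∑ j, u j (x j))| := le_abs_self _
    _ = |f x - ∑ j, u j (x j)| * |l x| := by rw [abs_mul, mul_comm]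
    _ ≤ c * |l x| := by gcongr; exact hu x hx

/-- If the support of a cycle vector is not a minimal cycle, the vector can be reduced by a
subordinate cycle vector that cancels one of the points. -/
lemma IsCycleVector.exists_subordinate {l : (∀ j, X j) →₀ ℝ} (h : IsCycleVector l)
    (hmin : ¬ IsMinimalCycle l.support) :
    ∃ l', IsCycleVector l' ∧ l'.support ⊂ l.support ∧ (∀ x, |l' x| ≤ |l x|) ∧
      ∃ x ∈ l.support, l' x = l x := by
  have : ∃ q ⊂ l.support, IsCycle q := by
    by_contra hcon
    push Not at hcon
    exact hmin ⟨⟨l, h, rfl⟩, hcon⟩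
  obtain ⟨q, hq, m, hm, rfl⟩ := this
  -- At a point of largest ratio, scaling `m` to agree with `l` keeps it dominated by `l` at every
  -- other point.
  obtain ⟨x₀, hx₀, hmax⟩ := m.support.exists_max_image (fun x => |m x| / |l x|)
    (Finsupp.support_nonempty_iff.2 hm.1)
  have hl₀ : l x₀ ≠ 0 := Finsupp.mem_support_iff.1 (hq.1 hx₀)
  have hm₀ : m x₀ ≠ 0 := Finsupp.mem_support_iff.1 hx₀
  have ht : l x₀ / m x₀ ≠ 0 := div_ne_zero hl₀ hm₀
  refine ⟨(l x₀ / m x₀) • m, hm.smul ht, ?_, fun x => ?_, x₀, hq.1 hx₀, ?_⟩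
  · rwa [Finsupp.support_smul_eq ht]
  · by_cases hx : x ∈ m.support
    · have h1 := hmax x hx
      have hlx : 0 < |l x| := abs_pos.2 (Finsupp.mem_support_iff.1 (hq.1 hx))
      have hl0' := abs_pos.2 hl₀
      have hm0' := abs_pos.2 hm₀
      rw [div_le_div_iff₀ hlx hl0'] at h1
      rw [Finsupp.smul_apply, smul_eq_mul, abs_mul, abs_div, div_mul_eq_mul_div,
        div_le_iff₀ hm0']
      linarith
    · simp [Finsupp.notMem_support_iff.1 hx]
  · simp [hm₀]

/-- When `a` dominates `b`, neither `a - b` nor `a + b` has the sign opposite to `a`. This makes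
total weights additive in the halving argument below. -/
lemma abs_sub_add_abs_add {a b : ℝ} (h : |b| ≤ |a|) : |a - b| + |a + b| = 2 * |a| := by
  rcases abs_cases a with ⟨h1, _⟩ | ⟨h1, _⟩ <;> rcases abs_cases b with ⟨h2, _⟩ | ⟨h2, _⟩ <;>
  rcases abs_cases (a - b) with ⟨h3, _⟩ | ⟨h3, _⟩ <;>
  rcases abs_cases (a + b) with ⟨h4, _⟩ | ⟨h4, _⟩ <;> linarith

/-- If no cycle vector in `G` has objective above `c` and one reaches `c`, then a minimal one
reaches `c`. -/
lemma exists_minimal_of_le {f : (∀ j, X j) → ℝ} {G : Finset (∀ j, X j)} {c : ℝ}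
    (hle : ∀ l : (∀ j, X j) →₀ ℝ, IsCycleVector l → l.support ⊆ G →
      pairing f l ≤ c * totalWeight l)
    (hex : ∃ l : (∀ j, X j) →₀ ℝ, IsCycleVector l ∧ l.support ⊆ G ∧
      c * totalWeight l ≤ pairing f l) :
    ∃ l : (∀ j, X j) →₀ ℝ, l ∈ minimalCycleVectors (G : Set (∀ j, X j)) ∧ objective f l = c := by
  obtain ⟨n, hn⟩ : ∃ n, ∃ l : (∀ j, X j) →₀ ℝ, (IsCycleVector l ∧ l.support ⊆ G ∧
      c * totalWeight l ≤ pairing f l) ∧ l.support.card = n := by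
    obtain ⟨l, hl⟩ := hex
    exact ⟨_, l, hl, rfl⟩
  induction n using Nat.strong_induction_on with
  | _ n ih =>
    obtain ⟨l, ⟨hl, hG, hge⟩, rfl⟩ := hn
    by_cases hmin : IsMinimalCycle l.support
    · refine ⟨l, ⟨hl, hmin, by exact_mod_cast hG⟩, ?_⟩
      rw [objective_eq, div_eq_iff (totalWeight_pos hl.1).ne']
      exact le_antisymm (hle l hl hG) hge
    obtain ⟨m, hm, hsub, habs, x₀, hx₀, hmx₀⟩ := hl.exists_subordinate hmin
    have hne : l ≠ m := fun e => hsub.ne (by rw [e])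
    have hne' : l ≠ (-1 : ℝ) • m := by
      intro e
      refine hsub.ne ?_
      rw [e, Finsupp.support_smul_eq (by norm_num)]
    have h1 := hl.sub hm hne
    have h2 := hl.sub (hm.smul (by norm_num : (-1 : ℝ) ≠ 0)) hne'
    have hs1 : (l - m).support ⊆ l.support := by
      intro x hx
      by_contra hxl
      have hxm : x ∉ m.support := fun hh => hxl (hsub.1 hh)
      rw [Finsupp.notMem_support_iff] at hxl hxm
      simp [hxl, hxm] at hx
    have hs2 : (l - (-1 : ℝ) • m).support ⊆ l.support := by
      intro x hx
      by_contra hxl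
      have hxm : x ∉ m.support := fun hh => hxl (hsub.1 hh)
      rw [Finsupp.notMem_support_iff] at hxl hxm
      simp [hxl, hxm] at hx
    have hlt : (l - m).support.card < l.support.card := by
      refine Finset.card_lt_card ⟨hs1, fun hcon => ?_⟩
      have := hcon hx₀
      simp [hmx₀] at this
    refine ih _ hlt ⟨l - m, ⟨h1, hs1.trans hG, ?_⟩, rfl⟩
    -- Here `l` is the midpoint of `l - m` and `l + m`, and its weight is the mean of theirs. Since
    -- `l + m` cannot exceed `c`, the vector `l - m`, of smaller support, still reaches `c`.
    have h3 := hle _ h2 (hs2.trans hG)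
    have h4 : totalWeight (l - m) + totalWeight (l - (-1 : ℝ) • m) = 2 * totalWeight l := by
      rw [totalWeight_eq_sum hs1, totalWeight_eq_sum hs2, totalWeight, ← Finset.sum_add_distrib,
        Finset.mul_sum]
      refine Finset.sum_congr rfl fun x _ => ?_
      simpa using abs_sub_add_abs_add (habs x)
    simp only [map_sub, map_smul, smul_eq_mul] at h3 ⊢
    nlinarith [congrArg (c * ·) h4]

/-- Best approximation by sums of functions of one coordinate on a finite set: the error is
reached by a functional of norm at most one that annihilates these sums. -/
lemma exists_best_approx_finite [Fintype ι] (f : (∀ j, X j) → ℝ) (G : Finset (∀ j, X j)) :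
    ∃ (u : ∀ j, X j → ℝ) (c : ℝ), (∀ x ∈ G, |f x - ∑ j, u j (x j)| ≤ c) ∧
      (c = 0 ∨ ∃ l : (∀ j, X j) →₀ ℝ, IsCycleVector l ∧ l.support ⊆ G ∧
        c * totalWeight l ≤ pairing f l) := by
  classical
  let T : (∀ j, X j → ℝ) →ₗ[ℝ] (G → ℝ) :=
    { toFun := fun u x => ∑ j, u j (x.1 j)
      map_add' := fun u v => by ext x; simp [Finset.sum_add_distrib]
      map_smul' := fun t u => by ext x; simp [Finset.mul_sum] }
  let W : Submodule ℝ (G → ℝ) := LinearMap.range T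
  have hWc : IsClosed (W : Set (G → ℝ)) := W.closed_of_finiteDimensional
  let F : G → ℝ := fun x => f x
  obtain ⟨w, hw, hdist⟩ := hWc.exists_infDist_eq_dist ⟨0, W.zero_mem⟩ F
  obtain ⟨u, rfl⟩ := hw
  refine ⟨u, ‖F - T u‖, fun x hx => ?_, ?_⟩
  · exact norm_le_pi_norm (F - T u) ⟨x, hx⟩
  by_cases h0 : ‖F - T u‖ = 0
  · exact Or.inl h0
  right
  have : IsClosed (W.toAddSubgroup : Set (G → ℝ)) := hWc
  -- The error is the norm of the class of `F` modulo `W`, so a norming functional on the quotient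
  -- automatically annihilates `W`.
  have hnorm : ‖(Submodule.Quotient.mk F : (G → ℝ) ⧸ W)‖ = ‖F - T u‖ := by
    rw [← dist_eq_norm, ← hdist]
    exact QuotientAddGroup.norm_mk (S := W.toAddSubgroup) F
  have : IsClosed (W : Set (G → ℝ)) := hWc
  obtain ⟨g, hg1, hg2⟩ := exists_dual_vector ℝ (Submodule.Quotient.mk F : (G → ℝ) ⧸ W)
    (by rwa [hnorm])
  let Λ : (G → ℝ) →ₗ[ℝ] ℝ := g.toLinearMap ∘ₗ W.mkQ
  have hΛle : ∀ h, Λ h ≤ ‖h‖ := fun h =>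
    calc Λ h ≤ ‖g (Submodule.Quotient.mk h)‖ := le_abs_self _
      _ ≤ ‖g‖ * ‖(Submodule.Quotient.mk h : (G → ℝ) ⧸ W)‖ := g.le_opNorm _
      _ ≤ ‖h‖ := by rw [hg1, one_mul]; exact Submodule.Quotient.norm_mk_le W h
  have hΛF : Λ F = ‖F - T u‖ := by rw [← hnorm]; exact hg2
  have hΛW : ∀ v, Λ (T v) = 0 := fun v => by
    have : W.mkQ (T v) = 0 := (Submodule.Quotient.mk_eq_zero W).2 ⟨v, rfl⟩
    rw [LinearMap.comp_apply, this, map_zero]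
  let e : G → ℝ := fun x => Λ fun y => if x = y then 1 else 0
  have hΛsum : ∀ h : G → ℝ, Λ h = ∑ x : G, h x * e x := fun h => Λ.pi_apply_eq_sum_univ h
  let l : (∀ j, X j) →₀ ℝ := Finsupp.onFinset G (fun x => if hx : x ∈ G then e ⟨x, hx⟩ else 0)
    fun x hx => by by_contra hxG; simp [hxG] at hx
  have hl : ∀ x : G, l x = e x := fun x => by simp [l]
  have hsupp : l.support ⊆ G := Finsupp.support_onFinset_subset
  have hpair : ∀ φ : (∀ j, X j) → ℝ, pairing φ l = Λ fun x => φ x := fun φ => by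
    rw [pairing_eq_sum φ hsupp, hΛsum, ← Finset.sum_coe_sort]
    exact Finset.sum_congr rfl fun x _ => by rw [hl, mul_comm]
  have hF : pairing f l = ‖F - T u‖ := by rw [hpair]; exact hΛF
  refine ⟨l, isCycleVector_iff.2 ⟨?_, fun j φ => ?_⟩, hsupp, ?_⟩
  · intro hl0
    rw [hl0, map_zero] at hF
    exact h0 hF.symm
  · rw [hpair]
    convert hΛW (Function.update 0 j φ) using 2
    ext x
    change _ = ∑ i, Function.update (0 : ∀ j, X j → ℝ) j φ i (x.1 i)
    rw [Finset.sum_eq_single j]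
    · simp
    · intro i _ hij
      simp [hij]
    · simp
  -- The sum of absolute values of the coefficients is the value of `Λ` at their sign pattern, which
  -- has sup norm at most one.
  · have hw : totalWeight l ≤ 1 := by
      rw [totalWeight_eq_sum hsupp, ← Finset.sum_coe_sort]
      calc _ = ∑ x : G, (SignType.sign (e x) : ℝ) * e x :=
            Finset.sum_congr rfl fun x _ => by rw [hl, sign_mul_self]
        _ = Λ fun x => (SignType.sign (e x) : ℝ) := (hΛsum _).symm
        _ ≤ _ := hΛle _
        _ ≤ 1 := (pi_norm_le_iff_of_nonneg zero_le_one).2 fun x => by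
          cases SignType.sign (e x) <;> simp
    rw [hF]
    exact mul_le_of_le_one_right (norm_nonneg _) hw

/-- Duality on a finite set carrying a cycle: the best approximation error by sums of functions of
one coordinate is the objective of a minimal cycle vector. -/
lemma exists_best_approx_eq_objective [Fintype ι] (f : (∀ j, X j) → ℝ) {G : Finset (∀ j, X j)}
    (hG : ∃ l : (∀ j, X j) →₀ ℝ, IsCycleVector l ∧ l.support ⊆ G) :
    ∃ (u : ∀ j, X j → ℝ) (c : ℝ), (∀ x ∈ G, |f x - ∑ j, u j (x j)| ≤ c) ∧
      ∃ l ∈ minimalCycleVectors (G : Set (∀ j, X j)), objective f l = c := by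
  obtain ⟨u, c, hu, hc⟩ := exists_best_approx_finite f G
  have hle : ∀ l : (∀ j, X j) →₀ ℝ, IsCycleVector l → l.support ⊆ G →
      pairing f l ≤ c * totalWeight l := fun l hl hs => hl.pairing_le fun x hx => hu x (hs hx)
  refine ⟨u, c, hu, exists_minimal_of_le hle ?_⟩
  -- With zero error there is no norming functional, but every cycle vector has nonpositive pairing,
  -- so the negative of any one reaches zero.
  rcases hc with rfl | hc
  · obtain ⟨l, hl, hs⟩ := hG
    refine ⟨(-1 : ℝ) • l, hl.smul (by norm_num), Finsupp.support_smul.trans hs, ?_⟩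
    have := hle l hl hs
    rw [map_smul, smul_eq_mul]
    linarith
  · exact hc

/-- A minimal cycle vector is determined up to a factor by its support. -/
lemma IsMinimalCycle.eq_smul {l l' : (∀ j, X j) →₀ ℝ} (hmin : IsMinimalCycle l.support)
    (hl : IsCycleVector l) (hl' : IsCycleVector l') (hs : l'.support = l.support)
    {x : ∀ j, X j} (hx : x ∈ l.support) : l = (l x / l' x) • l' := by
  by_contra hne
  have h0 : l x ≠ 0 := Finsupp.mem_support_iff.1 hx
  have h0' : l' x ≠ 0 := Finsupp.mem_support_iff.1 (hs ▸ hx)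
  have ht := div_ne_zero h0 h0'
  refine hmin.2 _ ⟨?_, fun hcon => ?_⟩ ⟨_, hl.sub (hl'.smul ht) hne, rfl⟩
  · intro y hy
    by_contra hyl
    have hyl' : y ∉ l'.support := hs ▸ hyl
    rw [Finsupp.notMem_support_iff] at hyl hyl'
    simp [hyl, hyl'] at hy
  · have := hcon hx
    simp [h0'] at this

/-- There are only finitely many minimal cycle vectors of total weight one in a finite set. -/
lemma finite_minimalCycleVectors {S : Set (∀ j, X j)} (hS : S.Finite) :
    {l ∈ minimalCycleVectors S | totalWeight l = 1}.Finite := by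
  classical
  -- Proportionality fixes the vector up to a factor, total weight one fixes the modulus of that
  -- factor, and the set of positive points fixes its sign.
  refine Set.Finite.of_finite_image (f := fun l : (∀ j, X j) →₀ ℝ =>
    (l.support, l.support.filter fun x => 0 < l x)) ?_ ?_
  · refine ((hS.toFinset.powerset ×ˢ hS.toFinset.powerset).finite_toSet).subset ?_
    rintro _ ⟨l, ⟨⟨-, -, hl⟩, -⟩, rfl⟩
    have : l.support ⊆ hS.toFinset := fun x hx => by simpa using hl hx
    simp only [Finset.coe_product, Set.mem_prod, Finset.mem_coe, Finset.mem_powerset]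
    exact ⟨this, (Finset.filter_subset _ _).trans this⟩
  · rintro l ⟨⟨hl, hmin, -⟩, hw⟩ l' ⟨⟨hl', -, -⟩, hw'⟩ heq
    obtain ⟨hs, hpos⟩ := Prod.mk.inj heq
    obtain ⟨x, hx⟩ := Finsupp.support_nonempty_iff.2 hl.1
    have hlx : l x ≠ 0 := Finsupp.mem_support_iff.1 hx
    have hlx' : l' x ≠ 0 := Finsupp.mem_support_iff.1 (hs ▸ hx)
    have hsign : 0 < l x ↔ 0 < l' x := by
      have := congrArg (x ∈ ·) hpos
      simpa [hlx, hlx'] using this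
    have h1 := hmin.eq_smul hl hl' hs.symm hx
    have h2 : |l x / l' x| = 1 := by
      have := congrArg totalWeight h1
      rwa [totalWeight_smul, hw, hw', mul_one, eq_comm] at this
    have h3 : 0 < l x / l' x := by
      rcases lt_or_gt_of_ne hlx with h | h
      · exact div_pos_of_neg_of_neg h
          (lt_of_le_of_ne (not_lt.1 fun h' => h.not_gt (hsign.2 h')) hlx')
      · exact div_pos h (hsign.1 h)
    rw [abs_of_pos h3] at h2
    rw [h1, h2, one_smul]

end Duality

/-! ### Pairs of measures with equal marginals and exchange of mass -/

section Plans

variable {ι : Type*} {X : ι → Type*}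

/-- Two nonnegative weight functions on `G` of mass one with the same marginals. -/
structure IsPlan (G : Finset (∀ j, X j)) (a b : (∀ j, X j) → ℝ) : Prop where
  nonneg_left : ∀ x, 0 ≤ a x
  nonneg_right : ∀ x, 0 ≤ b x
  left_eq_zero : ∀ x ∉ G, a x = 0
  right_eq_zero : ∀ x ∉ G, b x = 0
  mass_left : ∑ x ∈ G, a x = 1
  mass_right : ∑ x ∈ G, b x = 1
  marginals : ∀ j (φ : X j → ℝ), ∑ x ∈ G, a x * φ (x j) = ∑ x ∈ G, b x * φ (x j)

/-- All conditions are closed in the product topology, and total mass one puts every weight in `[0,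
1]`, so Tychonoff applies even though weights are indexed by the whole product. -/
lemma isCompact_setOf_isPlan (G : Finset (∀ j, X j)) :
    IsCompact {m : ((∀ j, X j) → ℝ) × ((∀ j, X j) → ℝ) | IsPlan G m.1 m.2} := by
  classical
  refine (isCompact_Icc (a := (0 : ((∀ j, X j) → ℝ) × ((∀ j, X j) → ℝ)))
    (b := (fun _ => 1, fun _ => 1))).of_isClosed_subset ?_ ?_
  · have : {m : ((∀ j, X j) → ℝ) × ((∀ j, X j) → ℝ) | IsPlan G m.1 m.2} =
        {m | ∀ x, 0 ≤ m.1 x} ∩ {m | ∀ x, 0 ≤ m.2 x} ∩ {m | ∀ x ∉ G, m.1 x = 0} ∩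
          {m | ∀ x ∉ G, m.2 x = 0} ∩ {m | ∑ x ∈ G, m.1 x = 1} ∩ {m | ∑ x ∈ G, m.2 x = 1} ∩
          {m | ∀ j (φ : X j → ℝ), ∑ x ∈ G, m.1 x * φ (x j) = ∑ x ∈ G, m.2 x * φ (x j)} := by
      ext m
      exact ⟨fun h => ⟨⟨⟨⟨⟨⟨h.1, h.2⟩, h.3⟩, h.4⟩, h.5⟩, h.6⟩, h.7⟩,
        fun ⟨⟨⟨⟨⟨⟨h1, h2⟩, h3⟩, h4⟩, h5⟩, h6⟩, h7⟩ => ⟨h1, h2, h3, h4, h5, h6, h7⟩⟩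
    rw [this]
    simp only [Set.ofPred_forall]
    refine IsClosed.inter (IsClosed.inter (IsClosed.inter (IsClosed.inter (IsClosed.inter
      (IsClosed.inter ?_ ?_) ?_) ?_) ?_) ?_) ?_
    · exact isClosed_iInter fun x => isClosed_le (by fun_prop) (by fun_prop)
    · exact isClosed_iInter fun x => isClosed_le (by fun_prop) (by fun_prop)
    · exact isClosed_iInter fun x => isClosed_iInter fun _ => isClosed_eq (by fun_prop) (by fun_prop)
    · exact isClosed_iInter fun x => isClosed_iInter fun _ => isClosed_eq (by fun_prop) (by fun_prop)
    · exact isClosed_eq (by fun_prop) (by fun_prop)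
    · exact isClosed_eq (by fun_prop) (by fun_prop)
    · exact isClosed_iInter fun j => isClosed_iInter fun φ =>
        isClosed_eq (by fun_prop) (by fun_prop)
  · rintro m ⟨h1, h2, h3, h4, h5, h6, -⟩
    refine ⟨⟨h1, h2⟩, ⟨fun x => ?_, fun x => ?_⟩⟩
    · by_cases hx : x ∈ G
      · exact (Finset.single_le_sum (fun y _ => h1 y) hx).trans h5.le
      · exact (h3 x hx).trans_le zero_le_one
    · by_cases hx : x ∈ G
      · exact (Finset.single_le_sum (fun y _ => h2 y) hx).trans h6.le
      · exact (h4 x hx).trans_le zero_le_one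

/-- The value `∫ f da - ∫ f db`. -/
def planValue (G : Finset (∀ j, X j)) (f : (∀ j, X j) → ℝ) (a b : (∀ j, X j) → ℝ) : ℝ :=
  ∑ x ∈ G, a x * f x - ∑ x ∈ G, b x * f x

/-- A plan of the largest value that, among these, has the largest integral `∫ Ψ da`. -/
structure IsOptimalPlan (G : Finset (∀ j, X j)) (f Ψ : (∀ j, X j) → ℝ)
    (a b : (∀ j, X j) → ℝ) : Prop extends IsPlan G a b where
  value_le : ∀ a' b', IsPlan G a' b' → planValue G f a' b' ≤ planValue G f a b
  potential_le : ∀ a' b', IsPlan G a' b' → planValue G f a b ≤ planValue G f a' b' →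
    ∑ x ∈ G, a' x * Ψ x ≤ ∑ x ∈ G, a x * Ψ x

/-- Compactness is used twice: first for the value, then for the potential on the closed set of
maximizers. -/
lemma exists_isOptimalPlan {G : Finset (∀ j, X j)} (f Ψ : (∀ j, X j) → ℝ)
    (h : ∃ a b, IsPlan G a b) : ∃ a b, IsOptimalPlan G f Ψ a b := by
  have hK := isCompact_setOf_isPlan G
  have hcont : Continuous fun m : ((∀ j, X j) → ℝ) × ((∀ j, X j) → ℝ) =>
      planValue G f m.1 m.2 := by
    unfold planValue
    fun_prop
  have hcont' : Continuous fun m : ((∀ j, X j) → ℝ) × ((∀ j, X j) → ℝ) =>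
      ∑ x ∈ G, m.1 x * Ψ x := by fun_prop
  obtain ⟨a₀, b₀, h₀⟩ := h
  obtain ⟨m, hm, hmax⟩ := hK.exists_isMaxOn ⟨(a₀, b₀), h₀⟩ hcont.continuousOn
  obtain ⟨n, ⟨hn, hnm⟩, hmax'⟩ :=
    (hK.inter_right (isClosed_le (continuous_const (y := planValue G f m.1 m.2)) hcont)).exists_isMaxOn
      ⟨m, hm, le_refl (planValue G f m.1 m.2)⟩ hcont'.continuousOn
  refine ⟨n.1, n.2, hn, fun a' b' h' => ?_, fun a' b' h' hle => ?_⟩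
  · exact (hmax (a := (a', b')) h').trans hnm
  · exact hmax' (a := (a', b')) ⟨h', le_trans hnm hle⟩

open Classical in
/-- The weight function `a` after moving weight `t` along each of the listed pairs. -/
def moveMass {Y : Type*} (a : Y → ℝ) (t : ℝ) (L : List (Y × Y)) (x : Y) : ℝ :=
  a x + t * (L.map fun p => (if x = p.2 then 1 else 0) - (if x = p.1 then (1 : ℝ) else 0)).sum

lemma sum_moveMass {Y : Type*} {G : Finset Y} (a : Y → ℝ) (t : ℝ) {L : List (Y × Y)}
    (hL : ∀ p ∈ L, p.1 ∈ G ∧ p.2 ∈ G) (F : Y → ℝ) :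
    ∑ x ∈ G, moveMass a t L x * F x =
      ∑ x ∈ G, a x * F x + t * (L.map fun p => F p.2 - F p.1).sum := by
  classical
  induction L with
  | nil => simp [moveMass]
  | cons p L ih =>
    obtain ⟨h1, h2⟩ := hL p List.mem_cons_self
    have h3 : ∀ x, moveMass a t (p :: L) x = moveMass a t L x +
        t * ((if x = p.2 then 1 else 0) - (if x = p.1 then (1 : ℝ) else 0)) := fun x => by
      simp only [moveMass, List.map_cons, List.sum_cons]
      ring
    simp only [h3, add_mul, Finset.sum_add_distrib,
      ih fun q hq => hL q (List.mem_cons_of_mem _ hq), List.map_cons, List.sum_cons]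
    have h4 : ∑ x ∈ G, t * ((if x = p.2 then 1 else 0) - (if x = p.1 then (1 : ℝ) else 0)) * F x =
        t * (F p.2 - F p.1) := by
      simp_rw [mul_assoc, ← Finset.mul_sum, sub_mul, Finset.sum_sub_distrib, ite_mul, one_mul,
        zero_mul]
      rw [Finset.sum_ite_eq' , Finset.sum_ite_eq', if_pos h1, if_pos h2]
    rw [h4]
    ring

/-- The factor `L.length` allows one point to be the source of several moves, as happens when
partners for different coordinates coincide. -/
lemma moveMass_nonneg {Y : Type*} {a : Y → ℝ} {t : ℝ} {L : List (Y × Y)} (ht : 0 ≤ t)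
    (ha : ∀ x, 0 ≤ a x) (hL : ∀ p ∈ L, t * L.length ≤ a p.1) (x : Y) : 0 ≤ moveMass a t L x := by
  classical
  have key : ∀ L' : List (Y × Y), -(L'.length : ℝ) ≤
      (L'.map fun p => (if x = p.2 then 1 else 0) - (if x = p.1 then (1 : ℝ) else 0)).sum := by
    intro L'
    induction L' with
    | nil => simp
    | cons p L' ih =>
      simp only [List.map_cons, List.sum_cons, List.length_cons]
      push_cast
      split_ifs <;> linarith
  by_cases hx : ∃ p ∈ L, x = p.1
  · obtain ⟨p, hp, rfl⟩ := hx
    have h1 := hL p hp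
    have h2 := mul_le_mul_of_nonneg_left (key L) ht
    unfold moveMass
    linarith
  · push Not at hx
    refine add_nonneg (ha x) (mul_nonneg ht (List.sum_nonneg fun r hr => ?_))
    obtain ⟨p, hp, rfl⟩ := List.mem_map.1 hr
    simp only [hx p hp, if_false, sub_zero]
    split_ifs <;> norm_num

lemma exists_pos_le_of_forall_pos {Y : Type*} (L : List Y) (v : Y → ℝ) (h : ∀ y ∈ L, 0 < v y) :
    ∃ t > 0, ∀ y ∈ L, t ≤ v y := by
  induction L with
  | nil => exact ⟨1, one_pos, by simp⟩
  | cons y L ih =>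
    obtain ⟨t, ht, hL⟩ := ih fun z hz => h z (List.mem_cons_of_mem _ hz)
    refine ⟨min t (v y), lt_min ht (h y List.mem_cons_self), fun z hz => ?_⟩
    rcases List.mem_cons.1 hz with rfl | hz
    · exact min_le_right _ _
    · exact (min_le_left _ _).trans (hL z hz)

/-- Moving points of the support of an optimal plan, with balanced marginals and without loss in
value, does not increase the potential. -/
lemma IsOptimalPlan.potential_move_le {G : Finset (∀ j, X j)} {f Ψ a b : (∀ j, X j) → ℝ}
    (h : IsOptimalPlan G f Ψ a b) {L R : List ((∀ j, X j) × (∀ j, X j))}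
    (hL : ∀ p ∈ L, 0 < a p.1 ∧ p.2 ∈ G) (hR : ∀ p ∈ R, 0 < b p.1 ∧ p.2 ∈ G)
    (hmarg : ∀ j (φ : X j → ℝ), (L.map fun p => φ (p.2 j) - φ (p.1 j)).sum =
      (R.map fun p => φ (p.2 j) - φ (p.1 j)).sum)
    (hf : (R.map fun p => f p.2 - f p.1).sum ≤ (L.map fun p => f p.2 - f p.1).sum) :
    (L.map fun p => Ψ p.2 - Ψ p.1).sum ≤ 0 := by
  obtain ⟨s, hs, hsL⟩ := exists_pos_le_of_forall_pos L (fun p => a p.1) fun p hp => (hL p hp).1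
  obtain ⟨r, hr, hrR⟩ := exists_pos_le_of_forall_pos R (fun p => b p.1) fun p hp => (hR p hp).1
  -- The added one keeps the denominator positive when both lists are empty.
  set t : ℝ := min s r / (L.length + R.length + 1) with ht_def
  have hden : (0 : ℝ) < L.length + R.length + 1 := by positivity
  have ht : 0 < t := div_pos (lt_min hs hr) hden
  have htm : t * (L.length + R.length + 1) = min s r := div_mul_cancel₀ _ hden.ne'
  have hl0 : (0 : ℝ) ≤ L.length := Nat.cast_nonneg _
  have hr0 : (0 : ℝ) ≤ R.length := Nat.cast_nonneg _
  have htL : t * L.length ≤ s := by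
    have := min_le_left s r
    nlinarith
  have htR : t * R.length ≤ r := by
    have := min_le_right s r
    nlinarith
  have hLG : ∀ p ∈ L, p.1 ∈ G ∧ p.2 ∈ G := fun p hp =>
    ⟨by by_contra hG; exact (hL p hp).1.ne' (h.left_eq_zero _ hG), (hL p hp).2⟩
  have hRG : ∀ p ∈ R, p.1 ∈ G ∧ p.2 ∈ G := fun p hp =>
    ⟨by by_contra hG; exact (hR p hp).1.ne' (h.right_eq_zero _ hG), (hR p hp).2⟩
  have hout : ∀ (c : (∀ j, X j) → ℝ) (M : List ((∀ j, X j) × (∀ j, X j))),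
      (∀ p ∈ M, p.1 ∈ G ∧ p.2 ∈ G) → ∀ x ∉ G, c x = 0 → moveMass c t M x = 0 := by
    intro c M hM x hx hc
    unfold moveMass
    rw [hc, zero_add, List.sum_eq_zero, mul_zero]
    intro v hv
    obtain ⟨p, hp, rfl⟩ := List.mem_map.1 hv
    have h1 : x ≠ p.1 := fun e => hx (e ▸ (hM p hp).1)
    have h2 : x ≠ p.2 := fun e => hx (e ▸ (hM p hp).2)
    simp [h1, h2]
  have hplan : IsPlan G (moveMass a t L) (moveMass b t R) := by
    refine ⟨moveMass_nonneg ht.le h.nonneg_left fun p hp => htL.trans (hsL p hp),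
      moveMass_nonneg ht.le h.nonneg_right fun p hp => htR.trans (hrR p hp),
      fun x hx => hout a L hLG x hx (h.left_eq_zero x hx),
      fun x hx => hout b R hRG x hx (h.right_eq_zero x hx), ?_, ?_, fun j φ => ?_⟩
    · have := sum_moveMass a t hLG fun _ => 1
      simpa [h.mass_left] using this
    · have := sum_moveMass b t hRG fun _ => 1
      simpa [h.mass_right] using this
    · rw [sum_moveMass a t hLG fun x => φ (x j), sum_moveMass b t hRG fun x => φ (x j),
        h.marginals, hmarg]
  have hval : planValue G f a b ≤ planValue G f (moveMass a t L) (moveMass b t R) := by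
    unfold planValue
    rw [sum_moveMass a t hLG, sum_moveMass b t hRG]
    nlinarith [mul_le_mul_of_nonneg_left hf ht.le]
  have hpot := h.potential_le _ _ hplan hval
  rw [sum_moveMass a t hLG] at hpot
  by_contra hcon
  push Not at hcon
  linarith [mul_pos ht hcon]

lemma IsPlan.swap {G : Finset (∀ j, X j)} {a b : (∀ j, X j) → ℝ} (h : IsPlan G a b) :
    IsPlan G b a :=
  ⟨h.2, h.1, h.4, h.3, h.6, h.5, fun j φ => (h.7 j φ).symm⟩

/-- The marginals for coordinate `j` agree on the slice through `P`, and `a` charges that slice. -/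
lemma IsPlan.exists_partner {G : Finset (∀ j, X j)} {a b : (∀ j, X j) → ℝ} (h : IsPlan G a b)
    {P : ∀ j, X j} (hP : 0 < a P) (j : ι) : ∃ N, 0 < b N ∧ N j = P j := by
  classical
  by_contra hcon
  push Not at hcon
  have hPG : P ∈ G := by
    by_contra hG
    exact hP.ne' (h.left_eq_zero _ hG)
  have h1 := h.marginals j fun ξ => if ξ = P j then 1 else 0
  have h2 : ∑ x ∈ G, b x * (if x j = P j then 1 else 0) = 0 := by
    refine Finset.sum_eq_zero fun x _ => ?_
    split_ifs with hx
    · rw [mul_one]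
      exact le_antisymm (not_lt.1 fun hb => hcon x hb hx) (h.nonneg_right x)
    · exact mul_zero _
  have h3 : a P * (if P j = P j then 1 else 0) ≤ ∑ x ∈ G, a x * (if x j = P j then 1 else 0) :=
    Finset.single_le_sum (f := fun x => a x * (if x j = P j then (1 : ℝ) else 0))
      (fun x _ => mul_nonneg (h.nonneg_left x) (by split_ifs <;> norm_num)) hPG
  rw [h1, h2, if_pos rfl, mul_one] at h3
  exact h3.not_gt hP

/-- Weak duality for plans, with the approximation error tested on the supports only. -/
lemma IsPlan.planValue_le [Fintype ι] {G : Finset (∀ j, X j)} {f a b : (∀ j, X j) → ℝ}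
    (h : IsPlan G a b) {u : ∀ j, X j → ℝ} {c : ℝ}
    (ha : ∀ x, 0 < a x → |f x - ∑ j, u j (x j)| ≤ c)
    (hb : ∀ x, 0 < b x → |f x - ∑ j, u j (x j)| ≤ c) : planValue G f a b ≤ 2 * c := by
  have h1 : ∑ x ∈ G, a x * ∑ j, u j (x j) = ∑ x ∈ G, b x * ∑ j, u j (x j) := by
    simp_rw [Finset.mul_sum]
    rw [Finset.sum_comm, Finset.sum_comm (s := G)]
    exact Finset.sum_congr rfl fun j _ => h.marginals j (u j)
  have h2 : ∑ x ∈ G, a x * (f x - ∑ j, u j (x j)) ≤ c := by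
    calc _ ≤ ∑ x ∈ G, a x * c := Finset.sum_le_sum fun x _ => by
            rcases (h.nonneg_left x).eq_or_lt with h0 | h0
            · simp [← h0]
            · exact mul_le_mul_of_nonneg_left ((le_abs_self _).trans (ha x h0)) h0.le
      _ = c := by rw [← Finset.sum_mul, h.mass_left, one_mul]
  have h3 : ∑ x ∈ G, b x * (∑ j, u j (x j) - f x) ≤ c := by
    calc _ ≤ ∑ x ∈ G, b x * c := Finset.sum_le_sum fun x _ => by
            rcases (h.nonneg_right x).eq_or_lt with h0 | h0
            · simp [← h0]
            · refine mul_le_mul_of_nonneg_left ?_ h0.le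
              have := neg_abs_le (f x - ∑ j, u j (x j))
              linarith [hb x h0]
      _ = c := by rw [← Finset.sum_mul, h.mass_right, one_mul]
  simp only [mul_sub, Finset.sum_sub_distrib] at h2 h3
  unfold planValue
  linarith

/-- The positive and negative parts of a cycle vector, normalized, form a plan. -/
lemma IsCycleVector.exists_isPlan {ι : Type*} [Nonempty ι] {X : ι → Type*}
    {l : (∀ j, X j) →₀ ℝ} (h : IsCycleVector l)
    {G : Finset (∀ j, X j)} (hG : l.support ⊆ G) (f : (∀ j, X j) → ℝ) :
    ∃ a b, IsPlan G a b ∧ planValue G f a b = 2 * objective f l := by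
  have hw := totalWeight_pos h.1
  set w := totalWeight l with hw_def
  have hsum : ∑ x ∈ G, l x = 0 := by
    have := h.pairing_eq_zero (Classical.arbitrary ι) fun _ => 1
    rw [pairing_eq_sum _ hG] at this
    simpa using this
  have habs : ∑ x ∈ G, |l x| = w := (totalWeight_eq_sum hG).symm
  -- Each part of `l` has mass `w / 2`, hence the doubled numerators and the factor two in the
  -- value.
  refine ⟨fun x => (|l x| + l x) / w, fun x => (|l x| - l x) / w,
    ⟨fun x => ?_, fun x => ?_, fun x hx => ?_, fun x hx => ?_, ?_, ?_, fun j φ => ?_⟩, ?_⟩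
  · exact div_nonneg (by linarith [neg_abs_le (l x)]) hw.le
  · exact div_nonneg (by linarith [le_abs_self (l x)]) hw.le
  · simp [Finsupp.notMem_support_iff.1 fun hh => hx (hG hh)]
  · simp [Finsupp.notMem_support_iff.1 fun hh => hx (hG hh)]
  · rw [← Finset.sum_div, Finset.sum_add_distrib, hsum, habs, add_zero, div_self hw.ne']
  · rw [← Finset.sum_div, Finset.sum_sub_distrib, hsum, habs, sub_zero, div_self hw.ne']
  · have := h.pairing_eq_zero j φ
    rw [pairing_eq_sum _ hG] at this
    rw [← sub_eq_zero, ← Finset.sum_sub_distrib]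
    calc _ = ∑ x ∈ G, 2 / w * (l x * φ (x j)) := Finset.sum_congr rfl fun x _ => by ring
      _ = 0 := by rw [← Finset.mul_sum, this, mul_zero]
  · rw [objective_eq, pairing_eq_sum f hG, planValue, ← Finset.sum_sub_distrib]
    calc _ = ∑ x ∈ G, 2 / w * (l x * f x) := Finset.sum_congr rfl fun x _ => by ring
      _ = _ := by rw [← Finset.mul_sum]; ring

end Plans

/-! ### From mixed differences to supermodularity -/

section Supermodularity

/-- `f` is supermodular for the coordinatewise order of the cube. -/
def Supermodular (f : Cube → ℝ) : Prop := ∀ P Q, f P + f Q ≤ f (P ⊔ Q) + f (P ⊓ Q)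

lemma cube_eta (P : Cube) : P = ![P 0, P 1, P 2] := by
  ext i; fin_cases i <;> rfl

lemma update_coord_zero (P : Cube) (t : I) : Function.update P 0 t = ![t, P 1, P 2] := by
  ext i; fin_cases i <;> simp

lemma update_coord_one (P : Cube) (t : I) : Function.update P 1 t = ![P 0, t, P 2] := by
  ext i; fin_cases i <;> simp

lemma update_coord_two (P : Cube) (t : I) : Function.update P 2 t = ![P 0, P 1, t] := by
  ext i; fin_cases i <;> simp

/-- Passing from incomparable points to their supremum and infimum raises one group of coordinates
against the other. In three coordinates one group is a single coordinate, so at most two mixed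
differences add up to the required inequality. -/
lemma supermodular_of_mixedDiffNonneg {f : Cube → ℝ} (hxy : MixedDiffNonneg 0 1 f)
    (hxz : MixedDiffNonneg 0 2 f) (hyz : MixedDiffNonneg 1 2 f) : Supermodular f := by
  have h01 : ∀ x y z x' y' : I, x ≤ x' → y ≤ y' →
      f ![x', y, z] + f ![x, y', z] ≤ f ![x', y', z] + f ![x, y, z] := by
    intro x y z x' y' hx hy
    have := hxy ![x, y, z] x' y' hx hy
    simp only [partialDiff, update_coord_zero, update_coord_one, Matrix.cons_val] at this
    linarith
  have h02 : ∀ x y z x' z' : I, x ≤ x' → z ≤ z' →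
      f ![x', y, z] + f ![x, y, z'] ≤ f ![x', y, z'] + f ![x, y, z] := by
    intro x y z x' z' hx hz
    have := hxz ![x, y, z] x' z' hx hz
    simp only [partialDiff, update_coord_zero, update_coord_two, Matrix.cons_val] at this
    linarith
  have h12 : ∀ x y z y' z' : I, y ≤ y' → z ≤ z' →
      f ![x, y', z] + f ![x, y, z'] ≤ f ![x, y', z'] + f ![x, y, z] := by
    intro x y z y' z' hy hz
    have := hyz ![x, y, z] y' z' hy hz
    simp only [partialDiff, update_coord_one, update_coord_two, Matrix.cons_val] at this
    linarith
  have key : ∀ P Q : Cube, P 0 ≤ Q 0 → f P + f Q ≤ f (P ⊔ Q) + f (P ⊓ Q) := by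
    intro P Q h0
    rw [cube_eta (P ⊔ Q), cube_eta (P ⊓ Q)]
    simp only [Pi.sup_apply, Pi.inf_apply]
    rw [cube_eta P, cube_eta Q]
    generalize P 0 = x, P 1 = y, P 2 = z, Q 0 = x', Q 1 = y', Q 2 = z' at *
    simp only [Matrix.cons_val]
    rcases le_total y y' with h1 | h1 <;> rcases le_total z z' with h2 | h2 <;>
      simp only [h0, h1, h2, sup_of_le_left, sup_of_le_right, inf_of_le_left, inf_of_le_right]
    · linarith
    · linarith [h02 x y z' x' z h0 h2, h12 x' y z' y' z h1 h2]
    · linarith [h01 x y' z x' y h0 h1, h12 x' y' z y z' h1 h2]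
    · linarith [h01 x y' z' x' y h0 h1, h02 x y z' x' z h0 h2]
  intro P Q
  rcases le_total (P 0) (Q 0) with h | h
  · exact key P Q h
  · rw [add_comm, sup_comm, inf_comm]
    exact key Q P h

end Supermodularity

/-! ### The potential that breaks ties between optimal plans -/

section Potential

lemma sum_coord {M : Type*} [AddCommMonoid M] {i j k : Fin 3} (hij : i ≠ j) (hik : i ≠ k)
    (hjk : j ≠ k) (g : Fin 3 → M) : ∑ l, g l = g i + g j + g k := by
  have : (Finset.univ : Finset (Fin 3)) = {i, j, k} := by
    revert i j k; decide
  rw [this, Finset.sum_insert (by simp [hij, hik]), Finset.sum_pair hjk, add_assoc]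

lemma coord_cases {i j k : Fin 3} (hij : i ≠ j) (hik : i ≠ k) (hjk : j ≠ k) (l : Fin 3) :
    l = i ∨ l = j ∨ l = k := by
  revert i j k l; decide

open Classical in
/-- The weight of a coordinate: nodes count, and endpoints count additionally. -/
def coordWeight (U : Set I) (t : I) : ℝ :=
  -- The square in `potential` lies between 0 and 9, below the endpoint bonus 10. A point off the
  -- node grid scores at most `2 * 110 + 9`, below the `300` guaranteed on the grid.
  (if t ∈ U then 100 else 0) + (if t = 0 ∨ t = 1 then 10 else 0)

/-- The potential that selects an optimal plan. -/
def potential (U : Fin 3 → Set I) (P : Cube) : ℝ :=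
  ∑ l, coordWeight (U l) (P l) + (∑ l, (P l : ℝ)) ^ 2

lemma coordWeight_le (U : Set I) (t : I) : coordWeight U t ≤ 110 := by
  unfold coordWeight; split_ifs <;> norm_num

lemma coordWeight_le_of_interior (U : Set I) {t : I} (h : ¬ (t = 0 ∨ t = 1)) :
    coordWeight U t ≤ 100 := by
  unfold coordWeight; rw [if_neg h]; split_ifs <;> norm_num

lemma le_coordWeight {U : Set I} {t : I} (h : t ∈ U) : 100 ≤ coordWeight U t := by
  unfold coordWeight; rw [if_pos h]; split_ifs <;> norm_num

lemma coordWeight_endpoint {U : Set I} {t : I} (h : t ∈ U) (h' : t = 0 ∨ t = 1) :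
    coordWeight U t = 110 := by
  unfold coordWeight; rw [if_pos h, if_pos h']; norm_num

lemma coordWeight_eq_zero {U : Set I} {t : I} (h : t ∉ U) (h' : ¬ (t = 0 ∨ t = 1)) :
    coordWeight U t = 0 := by
  unfold coordWeight; rw [if_neg h, if_neg h', add_zero]

lemma weights_le_potential (U : Fin 3 → Set I) (P : Cube) {i j k : Fin 3} (hij : i ≠ j) (hik : i ≠ k)
    (hjk : j ≠ k) : coordWeight (U i) (P i) + coordWeight (U j) (P j) + coordWeight (U k) (P k) ≤
      potential U P := by
  rw [potential, sum_coord hij hik hjk]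
  exact le_add_of_nonneg_right (sq_nonneg _)

lemma potential_le_weights (U : Fin 3 → Set I) (P : Cube) {i j k : Fin 3} (hij : i ≠ j) (hik : i ≠ k)
    (hjk : j ≠ k) : potential U P ≤
      coordWeight (U i) (P i) + coordWeight (U j) (P j) + coordWeight (U k) (P k) + 9 := by
  rw [potential, sum_coord hij hik hjk, sum_coord hij hik hjk]
  have h1 := (P i).2; have h2 := (P j).2; have h3 := (P k).2
  simp only [Set.mem_Icc] at h1 h2 h3
  have : ((P i : ℝ) + P j + P k) ^ 2 ≤ 3 ^ 2 :=
    pow_le_pow_left₀ (by linarith) (by linarith) 2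
  linarith

/-- The potential strictly increases when two incomparable points are replaced by their supremum
and infimum. -/
lemma potential_sup_inf (U : Fin 3 → Set I) {P Q : Cube} (h1 : ¬ P ≤ Q) (h2 : ¬ Q ≤ P) :
    potential U P + potential U Q < potential U (P ⊔ Q) + potential U (P ⊓ Q) := by
  have hmod : ∀ (l : Fin 3) (φ : I → ℝ), φ (P l) + φ (Q l) = φ ((P ⊔ Q) l) + φ ((P ⊓ Q) l) := by
    intro l φ
    rcases le_total (P l) (Q l) with h | h <;> simp [h, add_comm]
  have hw : ∑ l, coordWeight (U l) (P l) + ∑ l, coordWeight (U l) (Q l) =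
      ∑ l, coordWeight (U l) ((P ⊔ Q) l) + ∑ l, coordWeight (U l) ((P ⊓ Q) l) := by
    rw [← Finset.sum_add_distrib, ← Finset.sum_add_distrib]
    exact Finset.sum_congr rfl fun l _ => hmod l _
  have hs : ∑ l, (P l : ℝ) + ∑ l, (Q l : ℝ) =
      ∑ l, ((P ⊔ Q) l : ℝ) + ∑ l, ((P ⊓ Q) l : ℝ) := by
    rw [← Finset.sum_add_distrib, ← Finset.sum_add_distrib]
    exact Finset.sum_congr rfl fun l _ => hmod l fun t => (t : ℝ)
  have hlt : ∀ R S : Cube, R < S → ∑ l, (R l : ℝ) < ∑ l, (S l : ℝ) := by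
    intro R S hRS
    obtain ⟨hle, l, hl⟩ := Pi.lt_def.1 hRS
    exact Finset.sum_lt_sum (fun m _ => by exact_mod_cast hle m)
      ⟨l, Finset.mem_univ _, by exact_mod_cast hl⟩
  have hP := hlt P (P ⊔ Q) (left_lt_sup.2 h2)
  have hQ := hlt Q (P ⊔ Q) (right_lt_sup.2 h1)
  unfold potential
  have hm := eq_sub_of_add_eq' hs.symm
  rw [hm]
  -- The coordinate weights cancel. With `S`, `p`, `q` the coordinate sums of the supremum, `P` and
  -- `Q`, the squares gain `2 * (S - p) * (S - q)`.
  nlinarith [mul_pos (sub_pos.2 hP) (sub_pos.2 hQ)]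

end Potential

/-! ### Relative position of positive and negative points -/

section Localization

/-- The coordinate sets `U` contain the endpoints and maximum points of all the auxiliary functions:
the functions of an interior point with one correction on each of three hexagon edges, and the
functions on a face `u k = e` with two corrections on hexagon edges. -/
structure HasNodes (f : Cube → ℝ) (U : Fin 3 → Set I) : Prop where
  zero_mem : ∀ j, 0 ∈ U j
  one_mem : ∀ j, 1 ∈ U j
  exists_interior : ∀ N : Fin 3 → Cube,
    (∀ i j k, i ≠ j → i ≠ k → j ≠ k → (N i j = 0 ∧ N i k = 1) ∨ (N i j = 1 ∧ N i k = 0)) →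
    ∃ M : Cube, (∀ j, M j ∈ U j) ∧ ∀ u : Cube,
      f u - ∑ i, f (Function.update (N i) i (u i)) ≤ f M - ∑ i, f (Function.update (N i) i (M i))
  exists_face : ∀ i j k, i ≠ j → i ≠ k → j ≠ k → ∀ e e' : I,
    (e = 0 ∧ e' = 1) ∨ (e = 1 ∧ e' = 0) → ∀ A B : Cube, A j = e → A k = e' → B i = e → B k = e' →
    ∃ F : Cube, F k = e ∧ (∀ l, F l ∈ U l) ∧ ∀ u : Cube, u k = e →
      f u - f (Function.update A i (u i)) - f (Function.update B j (u j)) ≤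
        f F - f (Function.update A i (F i)) - f (Function.update B j (F j))

variable {f : Cube → ℝ} {U : Fin 3 → Set I} {V : Fin 3 → Finset I} {a b : Cube → ℝ}

lemma HasNodes.endpoint_mem (hU : HasNodes f U) {j : Fin 3} {t : I} (ht : t = 0 ∨ t = 1) :
    t ∈ U j := by
  rcases ht with rfl | rfl
  · exact hU.zero_mem j
  · exact hU.one_mem j

lemma update_mem_grid {P : Cube} (hP : P ∈ Fintype.piFinset V) {i : Fin 3} {t : I}
    (ht : t ∈ V i) : Function.update P i t ∈ Fintype.piFinset V := by
  rw [Fintype.mem_piFinset] at hP ⊢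
  intro l
  by_cases h : l = i
  · subst h; simpa using ht
  · simpa [h] using hP l

lemma IsPlan.left_mem {G : Finset Cube} (h : IsPlan G a b) {P : Cube} (hP : 0 < a P) : P ∈ G := by
  by_contra hG
  exact hP.ne' (h.left_eq_zero _ hG)

lemma IsPlan.right_mem {G : Finset Cube} (h : IsPlan G a b) {P : Cube} (hP : 0 < b P) : P ∈ G :=
  h.swap.left_mem hP

/-- The positive points of an optimal plan form a chain. -/
lemma IsOptimalPlan.le_or_le (h : IsOptimalPlan (Fintype.piFinset V) f (potential U) a b)
    (hf : Supermodular f) {P Q : Cube} (hP : 0 < a P) (hQ : 0 < a Q) : P ≤ Q ∨ Q ≤ P := by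
  by_contra hcon
  push Not at hcon
  have hPG := Fintype.mem_piFinset.1 (h.left_mem hP)
  have hQG := Fintype.mem_piFinset.1 (h.left_mem hQ)
  have := h.potential_move_le (L := [(P, P ⊔ Q), (Q, P ⊓ Q)]) (R := []) ?_ ?_ ?_ ?_
  · have h2 := potential_sup_inf U hcon.1 hcon.2
    simp only [List.map_cons, List.map_nil, List.sum_cons, List.sum_nil] at this
    linarith
  · intro p hp
    simp only [List.mem_cons, List.not_mem_nil, or_false] at hp
    rcases hp with rfl | rfl
    · refine ⟨hP, Fintype.mem_piFinset.2 fun l => ?_⟩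
      rcases le_total (P l) (Q l) with hl | hl <;> simp [hl, hPG l, hQG l]
    · refine ⟨hQ, Fintype.mem_piFinset.2 fun l => ?_⟩
      rcases le_total (P l) (Q l) with hl | hl <;> simp [hl, hPG l, hQG l]
  · simp
  · intro l φ
    rcases le_total (P l) (Q l) with hl | hl <;> simp [hl]
  · have := hf P Q
    simp only [List.map_cons, List.map_nil, List.sum_cons, List.sum_nil]
    linarith

lemma sup_update_one {P N : Cube} {i : Fin 3} (h : ∀ j, j ≠ i → N j ≤ P j) :
    P ⊔ Function.update N i 1 = Function.update P i 1 := by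
  ext l
  by_cases hl : l = i
  · subst hl; simp [unitInterval.le_one']
  · simp [hl, h l hl]

lemma inf_update_one {P N : Cube} {i : Fin 3} (hi : P i = N i) (h : ∀ j, j ≠ i → N j ≤ P j) :
    P ⊓ Function.update N i 1 = N := by
  ext l
  by_cases hl : l = i
  · subst hl; simp [hi, unitInterval.le_one']
  · simp [hl, h l hl]

lemma sup_update_zero {P N : Cube} {i : Fin 3} (hi : P i = N i) (h : ∀ j, j ≠ i → P j ≤ N j) :
    P ⊔ Function.update N i 0 = N := by
  ext l
  by_cases hl : l = i
  · subst hl; simp [hi]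
  · simp [hl, h l hl]

lemma inf_update_zero {P N : Cube} {i : Fin 3} (h : ∀ j, j ≠ i → P j ≤ N j) :
    P ⊓ Function.update N i 0 = Function.update P i 0 := by
  ext l
  by_cases hl : l = i
  · subst hl; simp
  · simp [hl, h l hl]

lemma exists_other_coords : ∀ i : Fin 3, ∃ j k : Fin 3, i ≠ j ∧ i ≠ k ∧ j ≠ k := by decide

/-- The endpoint bonus of 10 exceeds any possible loss in the square. -/
lemma potential_update_lt (hU : HasNodes f U) {P : Cube} {i : Fin 3} {t : I} (ht : t = 0 ∨ t = 1)
    (hi : ¬ (P i = 0 ∨ P i = 1)) : potential U P < potential U (Function.update P i t) := by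
  obtain ⟨j, k, hij, hik, hjk⟩ := exists_other_coords i
  have h1 := potential_le_weights U P hij hik hjk
  have h2 := weights_le_potential U (Function.update P i t) hij hik hjk
  simp only [Function.update_self, Function.update_of_ne hij.symm, Function.update_of_ne hik.symm,
    coordWeight_endpoint (hU.endpoint_mem ht) ht] at h2
  linarith [coordWeight_le_of_interior (U i) hi]

/-- A positive and a negative point that share an interior coordinate are incomparable in the
remaining coordinates. -/
lemma IsOptimalPlan.incomparable (h : IsOptimalPlan (Fintype.piFinset V) f (potential U) a b)
    (hf : Supermodular f) (hU : HasNodes f U) (hV : ∀ j, U j ⊆ V j) {P N : Cube} (hP : 0 < a P)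
    (hN : 0 < b N) {i : Fin 3} (hi : P i = N i) (hint : ¬ (P i = 0 ∨ P i = 1)) :
    (¬ ∀ j, j ≠ i → N j ≤ P j) ∧ ¬ ∀ j, j ≠ i → P j ≤ N j := by
  -- Moving both points to the same `t` keeps the marginals equal but raises the potential.
  -- Supermodularity supplies the value condition: at `t = 1` if `N` is below `P` in the other
  -- coordinates, at `t = 0` if above.
  have key : ∀ t : I, t = 0 ∨ t = 1 →
      f (Function.update N i t) - f N ≤ f (Function.update P i t) - f P → False := by
    intro t ht hle
    have htV : t ∈ V i := hV i (hU.endpoint_mem ht)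
    have := h.potential_move_le (L := [(P, Function.update P i t)])
      (R := [(N, Function.update N i t)]) ?_ ?_ ?_ ?_
    · simp only [List.map_cons, List.map_nil, List.sum_cons, List.sum_nil] at this
      linarith [potential_update_lt hU ht hint]
    · simpa using ⟨hP, fun l => Fintype.mem_piFinset.1 (update_mem_grid (h.left_mem hP) htV) l⟩
    · simpa using ⟨hN, fun l => Fintype.mem_piFinset.1 (update_mem_grid (h.right_mem hN) htV) l⟩
    · intro l φ
      by_cases hl : l = i
      · subst hl; simp [hi]
      · simp [hl]
    · simpa using hle
  refine ⟨fun hle => key 1 (Or.inr rfl) ?_, fun hle => key 0 (Or.inl rfl) ?_⟩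
  · have := hf P (Function.update N i 1)
    rw [sup_update_one hle, inf_update_one hi hle] at this
    linarith
  · have := hf P (Function.update N i 0)
    rw [sup_update_zero hi hle, inf_update_zero hle] at this
    linarith

lemma IsOptimalPlan.cross (h : IsOptimalPlan (Fintype.piFinset V) f (potential U) a b)
    (hf : Supermodular f) (hU : HasNodes f U) (hV : ∀ j, U j ⊆ V j) {P N : Cube} (hP : 0 < a P)
    (hN : 0 < b N) {i j k : Fin 3} (hij : i ≠ j) (hik : i ≠ k) (hjk : j ≠ k)
    (hi : P i = N i) (hint : ¬ (P i = 0 ∨ P i = 1)) :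
    (N j < P j ∧ P k < N k) ∨ (P j < N j ∧ N k < P k) := by
  obtain ⟨h1, h2⟩ := h.incomparable hf hU hV hP hN hi hint
  have aux : ∀ p : Fin 3 → Prop, (∀ l, l ≠ i → p l) ↔ p j ∧ p k := fun p =>
    ⟨fun hp => ⟨hp j hij.symm, hp k hik.symm⟩, fun hp l hl => by
      rcases coord_cases hij hik hjk l with rfl | rfl | rfl
      exacts [absurd rfl hl, hp.1, hp.2]⟩
  rw [aux fun l => N l ≤ P l, not_and_or, not_le, not_le] at h1
  rw [aux fun l => P l ≤ N l, not_and_or, not_le, not_le] at h2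
  rcases h1 with h1 | h1 <;> rcases h2 with h2 | h2
  · exact absurd h2 h1.not_gt
  · exact Or.inr ⟨h1, h2⟩
  · exact Or.inl ⟨h2, h1⟩
  · exact absurd h2 h1.not_gt

/-- A negative point has at most one interior coordinate. -/
lemma IsOptimalPlan.endpoint_of_interior
    (h : IsOptimalPlan (Fintype.piFinset V) f (potential U) a b)
    (hf : Supermodular f) (hU : HasNodes f U) (hV : ∀ j, U j ⊆ V j) {N : Cube}
    (hN : 0 < b N) {i j : Fin 3} (hij : i ≠ j) (hint : ¬ (N i = 0 ∨ N i = 1)) :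
    N j = 0 ∨ N j = 1 := by
  by_contra hj
  obtain ⟨k, hik, hjk⟩ : ∃ k : Fin 3, i ≠ k ∧ j ≠ k := by
    clear hint hj; revert i j; decide
  obtain ⟨P, hP, hPi⟩ := h.swap.exists_partner hN i
  obtain ⟨Q, hQ, hQj⟩ := h.swap.exists_partner hN j
  have h1 := h.cross hf hU hV hP hN hij hik hjk hPi (by rwa [hPi])
  have h2 := h.cross hf hU hV hQ hN hij.symm hjk hik hQj (by rwa [hQj])
  rw [← hPi, ← hQj] at *
  -- Comparability of `P` and `Q` fixes the direction of both crossings, which then put `P k` and `Q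
  -- k` on opposite sides of `N k` against the order.
  rcases h.le_or_le hf hP hQ with hle | hle
  · have := hle i; have := hle j; have := hle k
    grind
  · have := hle i; have := hle j; have := hle k
    grind

/-- A negative point with an interior coordinate lies on a hexagon edge, and the positive points
that share the coordinate are separated from it. -/
lemma IsOptimalPlan.hexagon (h : IsOptimalPlan (Fintype.piFinset V) f (potential U) a b)
    (hf : Supermodular f) (hU : HasNodes f U) (hV : ∀ j, U j ⊆ V j) {P N : Cube} (hP : 0 < a P)
    (hN : 0 < b N) {i j k : Fin 3} (hij : i ≠ j) (hik : i ≠ k) (hjk : j ≠ k)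
    (hi : N i = P i) (hint : ¬ (P i = 0 ∨ P i = 1)) :
    (N j = 0 ∧ N k = 1 ∧ P j ≠ 0 ∧ P k ≠ 1) ∨ (N j = 1 ∧ N k = 0 ∧ P j ≠ 1 ∧ P k ≠ 0) := by
  have h1 := h.cross hf hU hV hP hN hij hik hjk hi.symm hint
  have h2 := h.endpoint_of_interior hf hU hV hN hij (by rwa [hi])
  have h3 := h.endpoint_of_interior hf hU hV hN hik (by rwa [hi])
  rcases h1 with ⟨h4, h5⟩ | ⟨h4, h5⟩
  · left
    have h6 : N j = 0 := h2.resolve_right fun e => by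
      rw [e] at h4; exact h4.not_ge unitInterval.le_one'
    have h7 : N k = 1 := h3.resolve_left fun e => by
      rw [e] at h5; exact h5.not_ge unitInterval.nonneg'
    exact ⟨h6, h7, fun e => by simp [h6, e] at h4, fun e => by simp [h7, e] at h5⟩
  · right
    have h6 : N j = 1 := h2.resolve_left fun e => by
      rw [e] at h4; exact h4.not_ge unitInterval.nonneg'
    have h7 : N k = 0 := h3.resolve_right fun e => by
      rw [e] at h5; exact h5.not_ge unitInterval.le_one'
    exact ⟨h6, h7, fun e => by simp [h6, e] at h4, fun e => by simp [h7, e] at h5⟩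

end Localization

/-! ### Positive points lie on the grid of the nodes -/

section Localization

variable {f : Cube → ℝ} {U : Fin 3 → Set I} {V : Fin 3 → Finset I} {a b : Cube → ℝ}

/-- A positive point outside the grid of the nodes cannot be moved to this grid without loss. -/
lemma IsOptimalPlan.not_movable (h : IsOptimalPlan (Fintype.piFinset V) f (potential U) a b)
    (hU : HasNodes f U) (hV : ∀ j, U j ⊆ V j) {P P' : Cube} (hP : 0 < a P) {i : Fin 3}
    (hPi : P i ∉ U i) (hP' : ∀ l, P' l ∈ U l) {R : List (Cube × Cube)}
    (hR : ∀ p ∈ R, 0 < b p.1 ∧ p.2 ∈ Fintype.piFinset V)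
    (hmarg : ∀ (l : Fin 3) (φ : I → ℝ),
      φ (P' l) - φ (P l) = (R.map fun p => φ (p.2 l) - φ (p.1 l)).sum)
    (hle : (R.map fun p => f p.2 - f p.1).sum ≤ f P' - f P) : False := by
  have := h.potential_move_le (L := [(P, P')]) (R := R) ?_ hR (fun l φ => by simpa using hmarg l φ)
    (by simpa using hle)
  -- The potential would rise from at most 229 to at least 300.
  · obtain ⟨j, k, hij, hik, hjk⟩ := exists_other_coords i
    have h1 := potential_le_weights U P hij hik hjk
    have h2 := weights_le_potential U P' hij hik hjk
    rw [coordWeight_eq_zero hPi fun e => hPi (hU.endpoint_mem e)] at h1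
    simp only [List.map_cons, List.map_nil, List.sum_cons, List.sum_nil] at this
    linarith [coordWeight_le (U j) (P j), coordWeight_le (U k) (P k), le_coordWeight (hP' i),
      le_coordWeight (hP' j), le_coordWeight (hP' k)]
  · simpa using ⟨hP, fun l => hV l (hP' l)⟩

lemma IsOptimalPlan.update_mem (h : IsOptimalPlan (Fintype.piFinset V) f (potential U) a b)
    (hV : ∀ j, U j ⊆ V j) {N : Cube} (hN : 0 < b N) {i : Fin 3} {t : I} (ht : t ∈ U i) :
    0 < b N ∧ Function.update N i t ∈ Fintype.piFinset V :=
  ⟨hN, update_mem_grid (h.right_mem hN) (hV i ht)⟩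

/-- Each coordinate has a negative partner on a hexagon edge. Sliding the partners along their edges
balances any move of `P`, and the net gain is governed by one of the `g_i`, so moving `P` to its
maximum point loses nothing. -/
lemma IsOptimalPlan.node_of_interior
    (h : IsOptimalPlan (Fintype.piFinset V) f (potential U) a b)
    (hf : Supermodular f) (hU : HasNodes f U) (hV : ∀ j, U j ⊆ V j) {P : Cube} (hP : 0 < a P)
    (hint : ∀ i, ¬ (P i = 0 ∨ P i = 1)) (i : Fin 3) : P i ∈ U i := by
  by_contra hPi
  choose N hN hNP using h.exists_partner hP
  obtain ⟨M, hM, hmax⟩ := hU.exists_interior N fun i j k hij hik hjk => by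
    rcases h.hexagon hf hU hV hP (hN i) hij hik hjk (hNP i) (hint i) with h1 | h1
    · exact Or.inl ⟨h1.1, h1.2.1⟩
    · exact Or.inr ⟨h1.1, h1.2.1⟩
  have hself : ∀ i, Function.update (N i) i (P i) = N i := fun i => by
    rw [← hNP i, Function.update_eq_self]
  refine h.not_movable hU hV hP hPi hM
    (R := [(N 0, Function.update (N 0) 0 (M 0)), (N 1, Function.update (N 1) 1 (M 1)),
      (N 2, Function.update (N 2) 2 (M 2))]) ?_ (fun l φ => ?_) ?_
  · intro p hp
    simp only [List.mem_cons, List.not_mem_nil, or_false] at hp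
    rcases hp with rfl | rfl | rfl
    exacts [h.update_mem hV (hN 0) (hM 0), h.update_mem hV (hN 1) (hM 1),
      h.update_mem hV (hN 2) (hM 2)]
  · fin_cases l <;> simp [hNP]
  · have h1 := hmax P
    simp only [hself, Fin.sum_univ_three] at h1
    simp only [List.map_cons, List.map_nil, List.sum_cons, List.sum_nil]
    linarith

/-- Only two partners have to slide when `P` stays on its face; their edges turn the gain into a
difference of values of an `h_i`. -/
lemma IsOptimalPlan.node_of_face (h : IsOptimalPlan (Fintype.piFinset V) f (potential U) a b)
    (hU : HasNodes f U) (hV : ∀ j, U j ⊆ V j) {P A B : Cube} (hP : 0 < a P)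
    (hA : 0 < b A) (hB : 0 < b B) {i j k : Fin 3} (hij : i ≠ j) (hik : i ≠ k) (hjk : j ≠ k)
    {e e' : I} (he : (e = 0 ∧ e' = 1) ∨ (e = 1 ∧ e' = 0)) (hPk : P k = e) (hAi : A i = P i)
    (hAj : A j = e) (hAk : A k = e') (hBj : B j = P j) (hBi : B i = e) (hBk : B k = e')
    (l : Fin 3) : P l ∈ U l := by
  by_contra hPl
  obtain ⟨F, hFk, hF, hmax⟩ := hU.exists_face i j k hij hik hjk e e' he A B hAj hAk hBi hBk
  refine h.not_movable hU hV hP hPl hF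
    (R := [(A, Function.update A i (F i)), (B, Function.update B j (F j))]) ?_ (fun m φ => ?_) ?_
  · intro p hp
    simp only [List.mem_cons, List.not_mem_nil, or_false] at hp
    rcases hp with rfl | rfl
    exacts [h.update_mem hV hA (hF i), h.update_mem hV hB (hF j)]
  · rcases coord_cases hij hik hjk m with rfl | rfl | rfl
    · simp [hij, hAi]
    · simp [hij.symm, hBj]
    · simp [hik.symm, hjk.symm, hFk, hPk]
  · have h1 := hmax P hPk
    rw [← hAi, ← hBj, Function.update_eq_self, Function.update_eq_self] at h1
    simp only [List.map_cons, List.map_nil, List.sum_cons, List.sum_nil]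
    linarith

/-- Separation from the partners decides which hexagon edges they occupy: the face containing `P`
excludes one of the two alternatives for each. -/
lemma IsOptimalPlan.node_of_two_interior
    (h : IsOptimalPlan (Fintype.piFinset V) f (potential U) a b)
    (hf : Supermodular f) (hU : HasNodes f U) (hV : ∀ j, U j ⊆ V j) {P : Cube} (hP : 0 < a P)
    {i j k : Fin 3} (hij : i ≠ j) (hik : i ≠ k) (hjk : j ≠ k)
    (hi : ¬ (P i = 0 ∨ P i = 1)) (hj : ¬ (P j = 0 ∨ P j = 1)) (hk : P k = 0 ∨ P k = 1)
    (l : Fin 3) : P l ∈ U l := by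
  obtain ⟨A, hA, hAi⟩ := h.exists_partner hP i
  obtain ⟨B, hB, hBj⟩ := h.exists_partner hP j
  have h1 := h.hexagon hf hU hV hP hA hij hik hjk hAi hi
  have h2 := h.hexagon hf hU hV hP hB hij.symm hjk hik hBj hj
  rcases hk with hk | hk
  · have h3 := h1.resolve_right fun e => e.2.2.2 hk
    have h4 := h2.resolve_right fun e => e.2.2.2 hk
    exact h.node_of_face hU hV hP hA hB hij hik hjk (Or.inl ⟨rfl, rfl⟩) hk hAi h3.1 h3.2.1 hBj
      h4.1 h4.2.1 l
  · have h3 := h1.resolve_left fun e => e.2.2.2 hk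
    have h4 := h2.resolve_left fun e => e.2.2.2 hk
    exact h.node_of_face hU hV hP hA hB hij hik hjk (Or.inr ⟨rfl, rfl⟩) hk hAi h3.1 h3.2.1 hBj
      h4.1 h4.2.1 l

/-- The case of a positive point on an edge. -/
lemma IsOptimalPlan.node_of_one_interior
    (h : IsOptimalPlan (Fintype.piFinset V) f (potential U) a b)
    (hf : Supermodular f) (hU : HasNodes f U) (hV : ∀ j, U j ⊆ V j) {P A : Cube} (hP : 0 < a P)
    (hA : 0 < b A) {i j k : Fin 3} (hij : i ≠ j) (hik : i ≠ k) (hjk : j ≠ k)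
    (hi : ¬ (P i = 0 ∨ P i = 1)) (hj : P j = 1) (hk : P k = 0) (hAi : A i = P i)
    (hAj : A j = 0) (hAk : A k = 1) : P i ∈ U i := by
  by_contra hPi
  obtain ⟨B, hB, hBj⟩ := h.exists_partner hP j
  -- Otherwise `P ≤ B`. Two supermodular exchanges, lowering coordinate `j` of `P` and `B` and then
  -- coordinate `i` of `P` and `A`, bring `P` to the vertex 000 without loss.
  have hlt : B i < P i := by
    by_contra hle
    push Not at hle
    refine h.not_movable hU hV hP hPi (P' := Function.update (Function.update P j 0) i 0)
      (R := [(A, Function.update A i 0), (B, Function.update B j 0)]) ?_ ?_ (fun m φ => ?_) ?_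
    · intro m
      rcases coord_cases hij hik hjk m with rfl | rfl | rfl
      · simpa using hU.zero_mem _
      · simpa [hij.symm] using hU.zero_mem _
      · simpa [hik.symm, hjk.symm, hk] using hU.zero_mem _
    · intro p hp
      simp only [List.mem_cons, List.not_mem_nil, or_false] at hp
      rcases hp with rfl | rfl
      exacts [h.update_mem hV hA (hU.zero_mem i), h.update_mem hV hB (hU.zero_mem j)]
    · rcases coord_cases hij hik hjk m with rfl | rfl | rfl
      · simp [hij, hAi]
      · simp [hij.symm, hBj]
      · simp [hik.symm, hjk.symm]
    · have h1 := hf P (Function.update B j 0)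
      have h2 := hf (Function.update P j 0) (Function.update A i 0)
      have e1 : P ⊔ Function.update B j 0 = B := by
        ext m
        rcases coord_cases hij hik hjk m with rfl | rfl | rfl
        · simp [hij, hle]
        · simp [hBj]
        · simp [hjk.symm, hk]
      have e2 : P ⊓ Function.update B j 0 = Function.update P j 0 := by
        ext m
        rcases coord_cases hij hik hjk m with rfl | rfl | rfl
        · simp [hij, hle]
        · simp
        · simp [hjk.symm, hk]
      have hle' : ∀ m, m ≠ i → (Function.update P j 0) m ≤ A m := fun m hm => by
        rcases coord_cases hij hik hjk m with rfl | rfl | rfl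
        · exact absurd rfl hm
        · simp
        · simp [hjk.symm, hk]
      rw [e1, e2] at h1
      rw [sup_update_zero (by simp [hij, hAi]) hle', inf_update_zero hle'] at h2
      simp only [List.map_cons, List.map_nil, List.sum_cons, List.sum_nil]
      linarith
  by_cases hBk : B k = 0 ∨ B k = 1
  · rcases hBk with hBk | hBk
    -- Now `B ≤ P`, and the dual exchanges with `B` in coordinate `k` and `A` in coordinate `i`
    -- bring `P` to the vertex 111.
    · refine h.not_movable hU hV hP hPi (P' := Function.update (Function.update P k 1) i 1)
        (R := [(A, Function.update A i 1), (B, Function.update B k 1)]) ?_ ?_ (fun m φ => ?_) ?_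
      · intro m
        rcases coord_cases hij hik hjk m with rfl | rfl | rfl
        · simpa using hU.one_mem _
        · simpa [hij.symm, hjk, hj] using hU.one_mem _
        · simpa [hik.symm] using hU.one_mem _
      · intro p hp
        simp only [List.mem_cons, List.not_mem_nil, or_false] at hp
        rcases hp with rfl | rfl
        exacts [h.update_mem hV hA (hU.one_mem i), h.update_mem hV hB (hU.one_mem k)]
      · rcases coord_cases hij hik hjk m with rfl | rfl | rfl
        · simp [hik, hAi]
        · simp [hij.symm, hjk]
        · simp [hik.symm, hBk, hk]
      · have h1 := hf P (Function.update B k 1)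
        have h2 := hf (Function.update P k 1) (Function.update A i 1)
        have e1 : P ⊔ Function.update B k 1 = Function.update P k 1 := by
          ext m
          rcases coord_cases hij hik hjk m with rfl | rfl | rfl
          · simp [hik, hlt.le]
          · simp [hjk, hBj]
          · simp [hk]
        have e2 : P ⊓ Function.update B k 1 = B := by
          ext m
          rcases coord_cases hij hik hjk m with rfl | rfl | rfl
          · simp [hik, hlt.le]
          · simp [hjk, hBj]
          · simp [hk, hBk]
        have hle' : ∀ m, m ≠ i → A m ≤ (Function.update P k 1) m := fun m hm => by
          rcases coord_cases hij hik hjk m with rfl | rfl | rfl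
          · exact absurd rfl hm
          · simp [hAj]
          · simp [hAk]
        rw [e1, e2] at h1
        rw [sup_update_one hle', inf_update_one (by simp [hik, hAi]) hle'] at h2
        simp only [List.map_cons, List.map_nil, List.sum_cons, List.sum_nil]
        linarith
    -- An interior `B i` would place `B` on a hexagon edge, which is impossible with `B j = B k =
    -- 1`. So `B` is a vertex at which the face argument still applies.
    · have hBi : B i = 0 := by
        have : B i = 0 ∨ B i = 1 := by
          by_contra hBi
          obtain ⟨Q, hQ, hQi⟩ := h.swap.exists_partner hB i
          have := h.hexagon hf hU hV hQ hB hij hik hjk hQi.symm (by rwa [hQi])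
          simp [hBj, hj, hBk] at this
        exact this.resolve_right fun e => by
          rw [e] at hlt
          exact hlt.not_ge unitInterval.le_one'
      exact hPi (h.node_of_face hU hV hP hA hB hij hik hjk (Or.inl ⟨rfl, rfl⟩) hk hAi hAj hAk hBj
        hBi hBk i)
  · obtain ⟨Q, hQ, hQk⟩ := h.swap.exists_partner hB k
    have hpos : 0 < B k := unitInterval.pos_iff_ne_zero.2 fun e => hBk (Or.inl e)
    have hPQ : P ≤ Q := (h.le_or_le hf hP hQ).resolve_right fun hle => by
      have := hle k
      rw [hQk, hk] at this
      exact this.not_gt hpos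
    refine (h.incomparable hf hU hV hQ hB hQk (by rwa [hQk])).1 fun m hm => ?_
    rcases coord_cases hij hik hjk m with rfl | rfl | rfl
    · exact hlt.le.trans (hPQ m)
    · rw [hBj]; exact hPQ m
    · exact absurd rfl hm

/-- The positive points of an optimal plan lie on the grid of the nodes. -/
lemma IsOptimalPlan.left_node (h : IsOptimalPlan (Fintype.piFinset V) f (potential U) a b)
    (hf : Supermodular f) (hU : HasNodes f U) (hV : ∀ j, U j ⊆ V j) {P : Cube} (hP : 0 < a P)
    (i : Fin 3) : P i ∈ U i := by
  by_cases hi : P i = 0 ∨ P i = 1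
  · exact hU.endpoint_mem hi
  obtain ⟨j, k, hij, hik, hjk⟩ := exists_other_coords i
  by_cases hj : P j = 0 ∨ P j = 1 <;> by_cases hk : P k = 0 ∨ P k = 1
  · obtain ⟨A, hA, hAi⟩ := h.exists_partner hP i
    rcases h.hexagon hf hU hV hP hA hij hik hjk hAi hi with ⟨h1, h2, h3, h4⟩ | ⟨h1, h2, h3, h4⟩
    · exact h.node_of_one_interior hf hU hV hP hA hij hik hjk hi (hj.resolve_left h3)
        (hk.resolve_right h4) hAi h1 h2
    · exact h.node_of_one_interior hf hU hV hP hA hik hij hjk.symm hi (hk.resolve_left h4)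
        (hj.resolve_right h3) hAi h2 h1
  · exact h.node_of_two_interior hf hU hV hP hik hij hjk.symm hi hk hj i
  · exact h.node_of_two_interior hf hU hV hP hij hik hjk hi hj hk i
  · refine h.node_of_interior hf hU hV hP (fun l => ?_) i
    rcases coord_cases hij hik hjk l with rfl | rfl | rfl <;> assumption

/-- The value of a plan on a fine grid is at most twice the approximation error on the grid of the
nodes. -/
lemma planValue_le_of_nodes (hf : Supermodular f) (hU : HasNodes f U) (hV : ∀ j, U j ⊆ V j)
    {u : Fin 3 → I → ℝ} {c : ℝ} (hu : ∀ x : Cube, (∀ j, x j ∈ U j) → |f x - ∑ j, u j (x j)| ≤ c)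
    (hab : IsPlan (Fintype.piFinset V) a b) : planValue (Fintype.piFinset V) f a b ≤ 2 * c := by
  obtain ⟨a', b', h⟩ := exists_isOptimalPlan f (potential U) ⟨a, b, hab⟩
  refine (h.value_le a b hab).trans (h.planValue_le (u := u) (fun x hx => hu x ?_)
    fun x hx => hu x fun j => ?_)
  · exact fun j => h.left_node hf hU hV hx j
  -- Negative points need no localization of their own: each of their coordinates is shared with a
  -- positive point.
  · obtain ⟨P, hP, hPj⟩ := h.swap.exists_partner hx j
    exact hPj ▸ h.left_node hf hU hV hP j

end Localization

/-! ### The prescribed maximum points as nodes -/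

section Nodes

variable {f : Cube → ℝ} {M : Fin 8 → Cube} {F : Fin 6 → Cube}

lemma coord_permutation {i j k : Fin 3} (hij : i ≠ j) (hik : i ≠ k) (hjk : j ≠ k) :
    (i = 0 ∧ j = 1 ∧ k = 2) ∨ (i = 1 ∧ j = 0 ∧ k = 2) ∨ (i = 0 ∧ j = 2 ∧ k = 1) ∨
      (i = 2 ∧ j = 0 ∧ k = 1) ∨ (i = 1 ∧ j = 2 ∧ k = 0) ∨ (i = 2 ∧ j = 1 ∧ k = 0) := by
  revert i j k; decide

lemma finite_nodeSet (M : Fin 8 → Cube) (F : Fin 6 → Cube) : (nodeSet M F).Finite :=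
  ((Set.finite_range _).union (Set.finite_range _)).union (Set.finite_range _)

lemma vertex_mem_nodeSet (M : Fin 8 → Cube) (F : Fin 6 → Cube) (i : Fin 8) :
    vertex i ∈ nodeSet M F := Or.inl (Or.inl ⟨i, rfl⟩)

lemma exists_face_node (h : AreMaximizers f M F) (n : Fin 6) {k : Fin 3} {e : I} {g : Cube → ℝ}
    (hface : face n = {u | u k = e}) (hg : ∀ u : Cube, u k = e → g u = auxH f n u) :
    ∃ P : Cube, P k = e ∧ (∀ l, P l ∈ (fun u : Cube => u l) '' nodeSet M F) ∧
      ∀ u : Cube, u k = e → g u ≤ g P := by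
  obtain ⟨hF, hmax⟩ := h.2 n
  rw [hface] at hF hmax
  refine ⟨F n, hF, fun l => ⟨F n, Or.inr ⟨n, rfl⟩, rfl⟩, fun u hu => ?_⟩
  rw [hg u hu, hg (F n) hF]
  exact hmax u hu

/-- There are two hexagon edges in each of the three directions, giving the eight `g_i`. On a face
the two edges are determined, and exchanging `i` and `j` gives the same `h_i`. -/
lemma hasNodes_of_areMaximizers (h : AreMaximizers f M F) :
    HasNodes f fun j => (fun u : Cube => u j) '' nodeSet M F := by
  have hM : ∀ (n : Fin 8) (g : Cube → ℝ), (∀ u, g u = auxG f n u) →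
      ∃ P : Cube, (∀ l, P l ∈ (fun u : Cube => u l) '' nodeSet M F) ∧ ∀ u : Cube, g u ≤ g P := by
    intro n g hg
    refine ⟨M n, fun l => ⟨M n, Or.inl (Or.inr ⟨n, rfl⟩), rfl⟩, fun u => ?_⟩
    rw [hg, hg]
    exact h.1 n u
  constructor
  · exact fun j => ⟨vertex 0, vertex_mem_nodeSet M F 0, by fin_cases j <;> rfl⟩
  · exact fun j => ⟨vertex 7, vertex_mem_nodeSet M F 7, by fin_cases j <;> rfl⟩
  · intro N hN
    have hself : ∀ u : Cube, f u = f ![u 0, u 1, u 2] := fun u => congrArg f (cube_eta u)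
    refine (?_ : ∃ n, ∀ u, f u - ∑ i, f (Function.update (N i) i (u i)) = auxG f n u).elim
      fun n hn => hM n _ hn
    (rcases hN 0 1 2 (by decide) (by decide) (by decide) with ⟨h1, h2⟩ | ⟨h1, h2⟩ <;>
    rcases hN 1 0 2 (by decide) (by decide) (by decide) with ⟨h3, h4⟩ | ⟨h3, h4⟩ <;>
    rcases hN 2 0 1 (by decide) (by decide) (by decide) with ⟨h5, h6⟩ | ⟨h5, h6⟩) <;>
    [refine ⟨6, fun u => ?_⟩; refine ⟨7, fun u => ?_⟩; refine ⟨0, fun u => ?_⟩;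
      refine ⟨2, fun u => ?_⟩; refine ⟨5, fun u => ?_⟩; refine ⟨1, fun u => ?_⟩;
      refine ⟨4, fun u => ?_⟩; refine ⟨3, fun u => ?_⟩] <;>
    simp only [Fin.sum_univ_three, update_coord_zero, update_coord_one, update_coord_two, auxG,
      h1, h2, h3, h4, h5, h6, hself u] <;>
    ring
  · intro i j k hij hik hjk e e' he A B h1 h2 h3 h4
    have hself : ∀ u : Cube, f u = f ![u 0, u 1, u 2] := fun u => congrArg f (cube_eta u)
    suffices ∃ n, face n = {u | u k = e} ∧ ∀ u : Cube, u k = e →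
        f u - f (Function.update A i (u i)) - f (Function.update B j (u j)) = auxH f n u by
      obtain ⟨n, hn, hg⟩ := this
      exact exists_face_node h n hn hg
    (rcases he with ⟨rfl, rfl⟩ | ⟨rfl, rfl⟩ <;>
    rcases coord_permutation hij hik hjk with ⟨rfl, rfl, rfl⟩ | ⟨rfl, rfl, rfl⟩ |
      ⟨rfl, rfl, rfl⟩ | ⟨rfl, rfl, rfl⟩ | ⟨rfl, rfl, rfl⟩ | ⟨rfl, rfl, rfl⟩) <;>
    [refine ⟨0, rfl, fun u hu => ?_⟩; refine ⟨0, rfl, fun u hu => ?_⟩;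
      refine ⟨2, rfl, fun u hu => ?_⟩; refine ⟨2, rfl, fun u hu => ?_⟩;
      refine ⟨4, rfl, fun u hu => ?_⟩; refine ⟨4, rfl, fun u hu => ?_⟩;
      refine ⟨1, rfl, fun u hu => ?_⟩; refine ⟨1, rfl, fun u hu => ?_⟩;
      refine ⟨3, rfl, fun u hu => ?_⟩; refine ⟨3, rfl, fun u hu => ?_⟩;
      refine ⟨5, rfl, fun u hu => ?_⟩; refine ⟨5, rfl, fun u hu => ?_⟩] <;>
    simp only [update_coord_zero, update_coord_one, update_coord_two, auxH, h1, h2, h3, h4,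
      hself u, hu] <;>
    ring

lemma continuous_comp_vec (f : C(Cube, ℝ)) {Y : Type*} [TopologicalSpace Y] {p q r : Y → I}
    (hp : Continuous p) (hq : Continuous q) (hr : Continuous r) :
    Continuous fun y => f ![p y, q y, r y] :=
  f.continuous.comp (continuous_pi fun i => by fin_cases i <;> assumption)

lemma continuous_auxG (f : C(Cube, ℝ)) (i : Fin 8) : Continuous (auxG f i) := by
  have hc : ∀ l : Fin 3, Continuous fun u : Cube => u l := fun l => continuous_apply l
  have hv : ∀ {p q r : Cube → I}, Continuous p → Continuous q → Continuous r →
    Continuous fun y => f ![p y, q y, r y] := fun hp hq hr => continuous_comp_vec f hp hq hr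
  fin_cases i <;>
    exact (((hv (hc _) (hc _) (hc _)).sub (hv (by fun_prop) (by fun_prop) (by fun_prop))).sub
      (hv (by fun_prop) (by fun_prop) (by fun_prop))).sub
      (hv (by fun_prop) (by fun_prop) (by fun_prop))

lemma continuous_auxH (f : C(Cube, ℝ)) (i : Fin 6) : Continuous (auxH f i) := by
  have hv : ∀ {p q r : Cube → I}, Continuous p → Continuous q → Continuous r →
    Continuous fun y => f ![p y, q y, r y] := fun hp hq hr => continuous_comp_vec f hp hq hr
  fin_cases i <;>
    exact ((hv (by fun_prop) (by fun_prop) (by fun_prop)).sub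
      (hv (by fun_prop) (by fun_prop) (by fun_prop))).sub
      (hv (by fun_prop) (by fun_prop) (by fun_prop))

lemma exists_areMaximizers (f : C(Cube, ℝ)) :
    ∃ (M : Fin 8 → Cube) (F : Fin 6 → Cube), AreMaximizers f M F := by
  have hG : ∀ i, ∃ m : Cube, ∀ u : Cube, auxG f i u ≤ auxG f i m := fun i => by
    obtain ⟨m, -, hm⟩ := isCompact_univ.exists_isMaxOn (s := (Set.univ : Set Cube))
      Set.univ_nonempty (continuous_auxG f i).continuousOn
    exact ⟨m, fun u => hm (Set.mem_univ u)⟩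
  have hH : ∀ i, ∃ m ∈ face i, ∀ u ∈ face i, auxH f i u ≤ auxH f i m := fun i => by
    have hcl : IsClosed (face i) := by
      fin_cases i <;> exact isClosed_eq (continuous_apply _) continuous_const
    have hne : (face i).Nonempty := by
      fin_cases i
      exacts [⟨vertex 0, rfl⟩, ⟨vertex 7, rfl⟩, ⟨vertex 0, rfl⟩, ⟨vertex 7, rfl⟩, ⟨vertex 0, rfl⟩,
        ⟨vertex 7, rfl⟩]
    obtain ⟨m, hm, hmax⟩ := hcl.isCompact.exists_isMaxOn hne (continuous_auxH f i).continuousOn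
    exact ⟨m, hm, fun u hu => hmax hu⟩
  choose M hM using hG
  choose F hF using hH
  exact ⟨M, F, hM, hF⟩

end Nodes

/-! ### From finite grids to continuous approximation -/

section Approximation

/-- A cycle vector supported by four vertices of a face. -/
lemma exists_isCycleVector_of_mem {G : Finset Cube} (h₁ : ![0, 0, 0] ∈ G) (h₂ : ![1, 1, 0] ∈ G)
    (h₃ : ![1, 0, 0] ∈ G) (h₄ : ![0, 1, 0] ∈ G) :
    ∃ l : Cube →₀ ℝ, IsCycleVector l ∧ l.support ⊆ G := by
  classical
  let v : I → I → Cube := fun s t => ![s, t, 0]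
  let l : Cube →₀ ℝ := Finsupp.single (v 0 0) 1 + Finsupp.single (v 1 1) 1 -
    Finsupp.single (v 1 0) 1 - Finsupp.single (v 0 1) 1
  refine ⟨l, isCycleVector_iff.2 ⟨fun hl => ?_, fun j φ => ?_⟩, fun x hx => ?_⟩
  · have hv : ∀ s t : I, s ≠ 0 ∨ t ≠ 0 → v s t ≠ v 0 0 := by
      intro s t hst he
      have e0 := congrFun he 0
      have e1 := congrFun he 1
      simp only [v, Matrix.cons_val] at e0 e1
      exact hst.elim (fun hs => hs e0) fun ht => ht e1
    have := DFunLike.congr_fun hl (v 0 0)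
    simp [l, hv 1 1 (by simp), hv 1 0 (by simp), hv 0 1 (by simp)] at this
  · fin_cases j <;> simp [l, v, pairing]
  · by_contra hG
    have h : ∀ y ∈ G, y ≠ x := fun y hy e => hG (e ▸ hy)
    rw [Finsupp.mem_support_iff] at hx
    simp [l, v, h _ h₁, h _ h₂, h _ h₃, h _ h₄] at hx

lemma objective_le_approxError (f : C(Cube, ℝ)) {l : Cube →₀ ℝ} (hl : IsCycleVector l) :
    objective f l ≤ approxError f := by
  refine le_ciInf fun g => ?_
  rw [objective_eq, div_le_iff₀ (totalWeight_pos hl.1)]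
  refine hl.pairing_le (u := ![g.1, g.2.1, g.2.2]) fun x _ => ?_
  rw [Fin.sum_univ_three]
  exact ContinuousMap.norm_coe_le_norm (f - (g.1.comp ⟨fun u : Cube => u 0, continuous_apply 0⟩
        + g.2.1.comp ⟨fun u : Cube => u 1, continuous_apply 1⟩
        + g.2.2.comp ⟨fun u : Cube => u 2, continuous_apply 2⟩)) x

/-- A partition of unity subordinate to the balls of radius `δ` around a finite `δ`-net. -/
lemma exists_partition_of_net {Y : Type*} [MetricSpace Y] {δ : ℝ} {T : Finset Y}
    (hT : ∀ x, ∃ t ∈ T, dist x t < δ) :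
    ∃ ρ : Y → C(Y, ℝ), (∀ t x, 0 ≤ ρ t x) ∧ (∀ x, ∑ t ∈ T, ρ t x = 1) ∧
      ∀ t x, 0 < ρ t x → dist x t < δ := by
  have hpos : ∀ x, 0 < ∑ t ∈ T, max 0 (δ - dist x t) := fun x => by
    obtain ⟨t, ht, hd⟩ := hT x
    exact Finset.sum_pos' (fun _ _ => le_max_left _ _) ⟨t, ht, lt_max_of_lt_right (sub_pos.2 hd)⟩
  -- Normalized tent functions; the net property keeps the denominator positive.
  refine ⟨fun t => ⟨fun x => max 0 (δ - dist x t) / ∑ s ∈ T, max 0 (δ - dist x s), ?_⟩,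
    fun t x => div_nonneg (le_max_left _ _) (hpos x).le, fun x => ?_, fun t x h => ?_⟩
  · exact Continuous.div (by fun_prop) (by fun_prop) fun x => (hpos x).ne'
  · simp only [ContinuousMap.coe_mk]
    rw [← Finset.sum_div, div_self (hpos x).ne']
  · by_contra hd
    simp only [ContinuousMap.coe_mk] at h
    rw [max_eq_left (by linarith), zero_div] at h
    exact h.false

lemma abs_sub_sum_le {Y : Type*} {T : Finset Y} {ρ v : Y → ℝ} {A C : ℝ} (hρ : ∀ t, 0 ≤ ρ t)
    (hsum : ∑ t ∈ T, ρ t = 1) (h : ∀ t ∈ T, 0 < ρ t → |A - v t| ≤ C) :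
    |A - ∑ t ∈ T, ρ t * v t| ≤ C := by
  have h1 : A - ∑ t ∈ T, ρ t * v t = ∑ t ∈ T, ρ t * (A - v t) := by
    simp only [mul_sub, Finset.sum_sub_distrib]
    rw [← Finset.sum_mul, hsum, one_mul]
  calc _ ≤ ∑ t ∈ T, |ρ t * (A - v t)| := h1 ▸ Finset.abs_sum_le_sum_abs _ _
    _ ≤ ∑ t ∈ T, ρ t * C := Finset.sum_le_sum fun t ht => by
        rw [abs_mul, abs_of_nonneg (hρ t)]
        rcases (hρ t).eq_or_lt with h0 | h0
        · simp [← h0]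
        · exact mul_le_mul_of_nonneg_left (h t ht h0) h0.le
    _ = C := by rw [← Finset.sum_mul, hsum, one_mul]

/-- The approximation error is controlled by the errors on fine finite grids. -/
lemma approxError_le_of_grids (f : C(Cube, ℝ)) {c : ℝ} (V₀ : Fin 3 → Finset I)
    (h : ∀ V : Fin 3 → Finset I, (∀ j, V₀ j ⊆ V j) → ∃ u : Fin 3 → I → ℝ,
      ∀ x ∈ Fintype.piFinset V, |f x - ∑ j, u j (x j)| ≤ c) : approxError f ≤ c := by
  classical
  refine le_of_forall_pos_le_add fun ε hε => ?_
  obtain ⟨δ, hδ, hfδ⟩ := Metric.uniformContinuous_iff.1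
    (CompactSpace.uniformContinuous_of_continuous f.continuous) ε hε
  obtain ⟨T, hT⟩ : ∃ T : Finset I, ∀ x : I, ∃ t ∈ T, dist x t < δ := by
    obtain ⟨T, -, hTf, hT⟩ := (isCompact_univ (X := I)).finite_cover_balls hδ
    refine ⟨hTf.toFinset, fun x => ?_⟩
    simpa using hT (Set.mem_univ x)
  let V : Fin 3 → Finset I := fun j => V₀ j ∪ T
  obtain ⟨u, hu⟩ := h V fun j => Finset.subset_union_left
  have hV : ∀ j x, ∃ t ∈ V j, dist x t < δ := fun j x => by
    obtain ⟨t, ht, hd⟩ := hT x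
    exact ⟨t, Finset.mem_union_right _ ht, hd⟩
  choose ρ hρ hsum hdist using fun j => exists_partition_of_net (hV j)
  let φ : Fin 3 → C(I, ℝ) := fun j => ∑ t ∈ V j, u j t • ρ j t
  have hφ : ∀ j x, φ j x = ∑ t ∈ V j, ρ j t x * u j t := fun j x => by
    simp [φ, ContinuousMap.sum_apply, mul_comm]
  have hc : 0 ≤ c + ε := by
    obtain ⟨t₀, h0, -⟩ := hV 0 0
    obtain ⟨t₁, h1, -⟩ := hV 1 0
    obtain ⟨t₂, h2, -⟩ := hV 2 0
    have := hu ![t₀, t₁, t₂] (Fintype.mem_piFinset.2 fun j => by fin_cases j <;> assumption)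
    linarith [abs_nonneg (f ![t₀, t₁, t₂] - ∑ j, u j (![t₀, t₁, t₂] j : I))]
  refine (ciInf_le ⟨0, ?_⟩ (φ 0, φ 1, φ 2)).trans ?_
  · rintro _ ⟨g, rfl⟩
    exact norm_nonneg _
  rw [ContinuousMap.norm_le _ hc]
  intro x
  change |f x - (φ 0 (x 0) + φ 1 (x 1) + φ 2 (x 2))| ≤ c + ε
  -- The error at `x` is a convex combination of the numbers `f x - ∑ j, u j (t j)` with `t` in the
  -- grid near `x`. It is unfolded one coordinate at a time; uniform continuity then replaces `f x`
  -- by `f t` at cost `ε`.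
  have h0 : |(f x - φ 1 (x 1) - φ 2 (x 2)) - φ 0 (x 0)| ≤ c + ε := by
    rw [hφ 0]
    refine abs_sub_sum_le (fun t => hρ 0 t _) (hsum 0 _) fun t₀ ht₀ hp₀ => ?_
    have h1 : |(f x - u 0 t₀ - φ 2 (x 2)) - φ 1 (x 1)| ≤ c + ε := by
      rw [hφ 1]
      refine abs_sub_sum_le (fun t => hρ 1 t _) (hsum 1 _) fun t₁ ht₁ hp₁ => ?_
      have h2 : |(f x - u 0 t₀ - u 1 t₁) - φ 2 (x 2)| ≤ c + ε := by
        rw [hφ 2]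
        refine abs_sub_sum_le (fun t => hρ 2 t _) (hsum 2 _) fun t₂ ht₂ hp₂ => ?_
        have hx : dist x ![t₀, t₁, t₂] < δ := by
          refine (dist_pi_lt_iff hδ).2 fun j => ?_
          fin_cases j
          exacts [hdist 0 _ _ hp₀, hdist 1 _ _ hp₁, hdist 2 _ _ hp₂]
        have hd := hfδ hx
        have hg := hu ![t₀, t₁, t₂] (Fintype.mem_piFinset.2 fun j => by fin_cases j <;> assumption)
        rw [Real.dist_eq] at hd
        rw [Fin.sum_univ_three] at hg
        simp only [Matrix.cons_val] at hg
        rw [abs_le] at hg ⊢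
        rw [abs_lt] at hd
        constructor <;> linarith
      convert h2 using 2
      ring
    convert h1 using 2
    ring
  convert h0 using 2
  ring

end Approximation

end SumApprox

end

theorem theorem2p1 (f : C(SumApprox.Cube, ℝ))
    (hxy : SumApprox.MixedDiffNonneg 0 1 f)
    (hxz : SumApprox.MixedDiffNonneg 0 2 f)
    (hyz : SumApprox.MixedDiffNonneg 1 2 f) :
    (∃ (M : Fin 8 → SumApprox.Cube) (F : Fin 6 → SumApprox.Cube),
      SumApprox.AreMaximizers f M F) ∧
    ∀ (M : Fin 8 → SumApprox.Cube) (F : Fin 6 → SumApprox.Cube),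
      SumApprox.AreMaximizers f M F →
      (SumApprox.nodeSet M F).Finite ∧
      {l ∈ SumApprox.minimalCycleVectors (SumApprox.grid (SumApprox.nodeSet M F)) |
        SumApprox.totalWeight l = 1}.Finite ∧
      IsGreatest
        (SumApprox.objective f ''
          SumApprox.minimalCycleVectors (SumApprox.grid (SumApprox.nodeSet M F)))
        (SumApprox.approxError f) := by
  classical
  refine ⟨SumApprox.exists_areMaximizers f, fun M F h => ?_⟩
  have hfin := SumApprox.finite_nodeSet M F
  have hU := SumApprox.hasNodes_of_areMaximizers h
  set U : Fin 3 → Set unitInterval := fun j => (fun u : SumApprox.Cube => u j) ''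
    SumApprox.nodeSet M F with hU_def
  have hUfin : ∀ j, (U j).Finite := fun j => hfin.image _
  let V₀ : Fin 3 → Finset unitInterval := fun j => (hUfin j).toFinset
  have hmem : ∀ x : SumApprox.Cube, x ∈ Fintype.piFinset V₀ ↔ ∀ j, x j ∈ U j := fun x => by
    simp only [Fintype.mem_piFinset, V₀, Set.Finite.mem_toFinset]
  have hgrid : SumApprox.grid (SumApprox.nodeSet M F) =
      (Fintype.piFinset V₀ : Set SumApprox.Cube) := by
    ext x
    exact (hmem x).symm
  have hvertex : ∀ V : Fin 3 → Finset unitInterval, (∀ j, V₀ j ⊆ V j) →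
      ∃ l : SumApprox.Cube →₀ ℝ, SumApprox.IsCycleVector l ∧ l.support ⊆ Fintype.piFinset V := by
    intro V hV
    have hv : ∀ x : SumApprox.Cube, (∀ j, x j = 0 ∨ x j = 1) → x ∈ Fintype.piFinset V :=
      fun x hx => Fintype.mem_piFinset.2 fun j =>
        hV j ((Set.Finite.mem_toFinset _).2 (hU.endpoint_mem (hx j)))
    refine SumApprox.exists_isCycleVector_of_mem (hv _ ?_) (hv _ ?_) (hv _ ?_) (hv _ ?_) <;>
      intro j <;> fin_cases j <;> simp
  rw [hgrid]
  refine ⟨hfin, SumApprox.finite_minimalCycleVectors (Finset.finite_toSet _), ?_⟩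
  obtain ⟨u, c, hu, l, hl, hlc⟩ :=
    SumApprox.exists_best_approx_eq_objective f (hvertex V₀ fun _ => subset_rfl)
  -- The error `c'` on any refined grid is half the value of a plan there, and localization bounds
  -- that value by `2 * c`.
  have hle : SumApprox.approxError f ≤ c := by
    refine SumApprox.approxError_le_of_grids f V₀ fun V hV => ?_
    obtain ⟨u', c', hu', l', hl', hlc'⟩ :=
      SumApprox.exists_best_approx_eq_objective f (hvertex V hV)
    obtain ⟨a, b, hab, hval⟩ := hl'.1.exists_isPlan (G := Fintype.piFinset V)
      (by exact_mod_cast hl'.2.2) f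
    have hcc : SumApprox.planValue (Fintype.piFinset V) f a b ≤ 2 * c :=
      SumApprox.planValue_le_of_nodes (SumApprox.supermodular_of_mixedDiffNonneg hxy hxz hyz) hU
        (fun j x hx => hV j ((Set.Finite.mem_toFinset _).2 hx))
        (fun x hx => hu x ((hmem x).2 hx)) hab
    exact ⟨u', fun x hx => (hu' x hx).trans (by linarith)⟩
  refine ⟨⟨l, hl, le_antisymm (SumApprox.objective_le_approxError f hl.1) (hlc ▸ hle)⟩, ?_⟩
  rintro _ ⟨m, hm, rfl⟩
  exact SumApprox.objective_le_approxError f hm.1
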